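/- Let $R$ be a (unital, not necessarily commutative) ring; $\otimes$ means $\otimes_R$. A $2$-fold bimodule $\Lambda=\Lambda_{B,A}$ is a left $R$-module with two right $R$-module structures ($\odot_1$, labelled $B$, and $\odot_2$, labelled $A$) that commute with the left structure and with each other; in $\Lambda_{B,A}\otimes A\otimes B$ the module $A$ is tensored to $\odot_2$ and $B$ to $\odot_1$, and right structures not used to form a tensor product remain available on it. An additive symmetric monoidal structure $\wedge$ on the category of left $R$-modules is represented by $\Lambda$ if an isomorphism $\Lambda_{B,A}\otimes A\otimes B\cong A\wedge B$, natural in $A$ and $B$, is given. If $K$ is the unit of $\wedge$, then evaluating the commutativity, left unit and associativity isomorphisms of $\wedge$ at $(R,R)$, $R$ and $(R,R,R)$ gives isomorphisms $c\colon\Lambda_{B,A}\to\Lambda_{A,B}$, $\ell\colon\Lambda_{B,K}\otimes K\to R_B$, $a\colon\Lambda_{C,\Lambda}\otimes\Lambda_{B,A}\to\Lambda_{\Lambda,A}\otimes\Lambda_{C,B}$ of $2$-fold bimodules, bimodules and $3$-fold bimodules. **Theorem.** Let $\wedge$ and $\Box$ be additive symmetric monoidal structures on left $R$-modules with units $K$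 and $K'$, represented by the $2$-fold bimodules $\Lambda$ and $\Gamma$. For an $R$-bimodule $X$ (also written $Y$, $Z$) consider pairs consisting of an isomorphism $\eta\colon K'\to X\otimes K$ of left $R$-modules and an isomorphism $m\colon\Gamma_{Y,X}\otimes X\otimes Y\to X\otimes\Lambda$ of $2$-fold bimodules (the right structure of $Y$ corresponds to $\odot_1$ on $\Lambda$, that of $X$ to $\odot_2$) such that the following hold, where $T$ denotes permutations of tensor factors: 1. (Unit) the composite $\Gamma_{Y,K'}\otimes K'\otimes Y\xrightarrow{1\otimes\eta\otimes1}\Gamma_{Y,X}\otimes X_K\otimes K\otimes Y\xrightarrow{1\otimes 1\otimes T}\Gamma_{Y,X}\otimes X_K\otimes Y\otimes K\xrightarrow{m\otimes 1}X\otimes\Lambda_{Y,K}\otimes K\xrightarrow{1\otimes\ell}X$ equals $\ell\otimes1$; 2. (Commutativity) $(1\otimes c)\circ m=m\circ(c\otimes T)$ as maps $\Gamma_{Y,X}\otimes X\otimes Y\to X\otimes\Lambda$; 3. (Associativity) the composites $$\Gamma_{Z,\Gamma}\otimes\Gamma_{Y,X}\otimes X\otimes Y\otimes Z\xrightarrow{m}\Gamma_{Z,X}\otimes(X\otimes\Lambda)\otimes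 Z\xrightarrow{T}\Gamma_{Z,X}\otimes X\otimes Z\otimes\Lambda\xrightarrow{m\otimes1}X\otimes\Lambda\otimes\Lambda\xrightarrow{1\otimes a}X\otimes\Lambda\otimes\Lambda$$ and $$\Gamma_{Z,\Gamma}\otimes\Gamma_{Y,X}\otimes X\otimes Y\otimes Z\xrightarrow{a\otimes T}\Gamma_{\Gamma,X}\otimes\Gamma_{Z,Y}\otimes Y\otimes Z\otimes X\xrightarrow{1\otimes m\otimes1}\Gamma_{X,X}\otimes(X\otimes\Lambda)\otimes X\xrightarrow{T}\Gamma_{X,X}\otimes X\otimes X\otimes\Lambda\xrightarrow{m\otimes 1}X\otimes\Lambda\otimes\Lambda$$ are equal. Then additive (strong) symmetric monoidal functors from $\wedge$ to $\Box$ that have a right adjoint are equivalent to triples $(X,\eta,m)$ of this kind. Precisely: for every bimodule $X$ the functor $X\otimes-$ is additive and has a right adjoint, and the pairs $(\eta,m)$ as above are in bijection with the strong symmetric monoidal structures on $X\otimes-$ from $\wedge$ to $\Box$; the structure belonging to $(\eta,m)$ has unit map $\eta$ and product maps $(X\otimes M)\,\Box\,(X\otimes N)\cong(\Gamma_{Y,X}\otimes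 X\otimes Y)\otimes M\otimes N\xrightarrow{m\otimes1\otimes1}(X\otimes\Lambda_{N,M})\otimes M\otimes N\cong X\otimes(M\wedge N)$. Every additive strong symmetric monoidal functor from $\wedge$ to $\Box$ with a right adjoint is isomorphic, by a monoidal natural isomorphism, to one of these. Finally, a natural transformation $X\otimes-\to X'\otimes-$ between the functors belonging to $(X,\eta,m)$ and $(X',\eta',m')$ is monoidal if and only if it is $f\otimes-$ for a (necessarily unique) bimodule map $f\colon X\to X'$ with $(f\otimes1)\eta=\eta'$ and $(f\otimes1)m=m'(1\otimes f\otimes f)$. -/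

import Mathlib

open CategoryTheory MonoidalCategory
open scoped TensorProduct

universe u

/-! ## Commuting right actions and tensor products over a noncommutative ring -/

/-- A right `R`-module structure on the left `R`-module `M` which commutes with the left
structure.  The element `ρ (op r) x` is the product `x ⊙ r` of the right structure `ρ`. -/
abbrev RightAct (R : Type u) [Ring R] (M : Type u) [AddCommGroup M] [Module R M] : Type u :=
  Rᵐᵒᵖ →+* Module.End R M

/-- Two right structures on the same module commute with each other. -/
class ActComm {R : Type u} [Ring R] {M : Type u} [AddCommGroup M] [Module R M]
    (ρ σ : RightAct R M) : Prop where
  comm : ∀ (r s : Rᵐᵒᵖ) (x : M), ρ r (σ s x) = σ s (ρ r x)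

/-- The left linear map `f` is also a map of right modules, from the right structure `ρ` of its
source to the right structure `σ` of its target. -/
def Intertwines {R : Type u} [Ring R] {M M' : Type u} [AddCommGroup M] [Module R M]
    [AddCommGroup M'] [Module R M'] (ρ : RightAct R M) (σ : RightAct R M')
    (f : M →ₗ[R] M') : Prop :=
  ∀ (r : Rᵐᵒᵖ) (x : M), f (ρ r x) = σ r (f x)

theorem Intertwines.id {R : Type u} [Ring R] {M : Type u} [AddCommGroup M] [Module R M]
    (ρ : RightAct R M) : Intertwines ρ ρ LinearMap.id := fun _ _ => rfl

theorem Intertwines.symm {R : Type u} [Ring R] {M M' : Type u} [AddCommGroup M] [Module R M]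
    [AddCommGroup M'] [Module R M'] {ρ : RightAct R M} {σ : RightAct R M'}
    {e : M ≃ₗ[R] M'} (h : Intertwines ρ σ e.toLinearMap) :
    Intertwines σ ρ e.symm.toLinearMap := by
  intro r x
  have := h r (e.symm x)
  simp only [LinearEquiv.coe_coe, LinearEquiv.apply_symm_apply] at this ⊢
  rw [← this, LinearEquiv.symm_apply_apply]

theorem ActComm.intertwines {R : Type u} [Ring R] {M : Type u} [AddCommGroup M] [Module R M]
    (ρ σ : RightAct R M) [ActComm ρ σ] (r : Rᵐᵒᵖ) : Intertwines ρ ρ (σ r) :=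
  fun s x => (ActComm.comm s r x).symm

/-- The relations `x ⊙ r ⊗ n = x ⊗ r n`. -/
def tensRel {R : Type u} [Ring R] {M : Type u} [AddCommGroup M] [Module R M]
    (ρ : RightAct R M) (N : Type u) [AddCommGroup N] [Module R N] : Submodule R (M ⊗[ℤ] N) :=
  Submodule.span R {t | ∃ (x : M) (r : R) (n : N),
    t = (ρ (MulOpposite.op r) x) ⊗ₜ[ℤ] n - x ⊗ₜ[ℤ] (r • n)}

/-- The tensor product `M ⊗_R N` formed with the right structure `ρ` of `M` and the left
structure of `N`; it is a left `R`-module through the left structure of `M`. -/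
def Tens {R : Type u} [Ring R] {M : Type u} [AddCommGroup M] [Module R M]
    (ρ : RightAct R M) (N : Type u) [AddCommGroup N] [Module R N] : Type u :=
  (M ⊗[ℤ] N) ⧸ tensRel ρ N

namespace Tens

section

variable {R : Type u} [Ring R] {M M' M'' N N' N'' P Q : Type u}
  [AddCommGroup M] [Module R M] [AddCommGroup M'] [Module R M']
  [AddCommGroup M''] [Module R M'']
  [AddCommGroup N] [Module R N] [AddCommGroup N'] [Module R N']
  [AddCommGroup N''] [Module R N'']
  [AddCommGroup P] [Module R P] [AddCommGroup Q] [Module R Q]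

instance (ρ : RightAct R M) : AddCommGroup (Tens ρ N) :=
  inferInstanceAs (AddCommGroup ((M ⊗[ℤ] N) ⧸ tensRel ρ N))

instance (ρ : RightAct R M) : Module R (Tens ρ N) :=
  inferInstanceAs (Module R ((M ⊗[ℤ] N) ⧸ tensRel ρ N))

/-- The class of `x ⊗ n`, as a biadditive map which is left linear in `x`. -/
def mk (ρ : RightAct R M) (N : Type u) [AddCommGroup N] [Module R N] :
    M →ₗ[R] N →ₗ[ℤ] Tens ρ N where
  toFun x := ((tensRel ρ N).mkQ.restrictScalars ℤ).comp (TensorProduct.mk ℤ M N x)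
  map_add' x y := by
    apply LinearMap.ext; intro n
    show (tensRel ρ N).mkQ ((x + y) ⊗ₜ n) = (tensRel ρ N).mkQ (x ⊗ₜ n) + (tensRel ρ N).mkQ (y ⊗ₜ n)
    rw [TensorProduct.add_tmul, map_add]
  map_smul' r x := by
    apply LinearMap.ext; intro n
    show (tensRel ρ N).mkQ ((r • x) ⊗ₜ n) = r • (tensRel ρ N).mkQ (x ⊗ₜ n)
    rw [← TensorProduct.smul_tmul', map_smul]

/-- The class of `x ⊗ n`. -/
def tmul (ρ : RightAct R M) (x : M) (n : N) : Tens ρ N := mk ρ N x n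

theorem tmul_add (ρ : RightAct R M) (x : M) (n n' : N) :
    tmul ρ x (n + n') = tmul ρ x n + tmul ρ x n' := map_add _ _ _

theorem add_tmul (ρ : RightAct R M) (x x' : M) (n : N) :
    tmul ρ (x + x') n = tmul ρ x n + tmul ρ x' n := by
  simp [tmul]

theorem smul_tmul (ρ : RightAct R M) (r : R) (x : M) (n : N) :
    tmul ρ (r • x) n = r • tmul ρ x n := by
  simp [tmul]

theorem act_tmul (ρ : RightAct R M) (r : R) (x : M) (n : N) :
    tmul ρ (ρ (MulOpposite.op r) x) n = tmul ρ x (r • n) := by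
  refine (Submodule.Quotient.eq (tensRel ρ N)).2 (Submodule.subset_span ⟨x, r, n, rfl⟩)

theorem zero_tmul (ρ : RightAct R M) (n : N) : tmul ρ (0 : M) n = 0 := by simp [tmul]

theorem tmul_zero (ρ : RightAct R M) (x : M) : tmul ρ x (0 : N) = 0 := map_zero _

theorem induction_on {ρ : RightAct R M} {p : Tens ρ N → Prop} (t : Tens ρ N)
    (tmul : ∀ x n, p (tmul ρ x n)) (add : ∀ s t, p s → p t → p (s + t)) : p t := by
  obtain ⟨t, rfl⟩ := Submodule.Quotient.mk_surjective _ t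
  induction t using TensorProduct.induction_on with
  | zero =>
    have h := tmul 0 0
    have h0 : Tens.tmul ρ (0 : M) (0 : N) = 0 := map_zero _
    rw [h0] at h
    exact h
  | tmul x n => exact tmul x n
  | add s t hs ht => exact add _ _ hs ht

theorem hom_ext {ρ : RightAct R M} {f g : Tens ρ N →ₗ[R] P}
    (h : ∀ x n, f (tmul ρ x n) = g (tmul ρ x n)) : f = g := by
  apply LinearMap.ext
  intro t
  induction t using induction_on with
  | tmul x n => exact h x n
  | add s t hs ht => rw [map_add, map_add, hs, ht]

/-- The additive map out of the tensor product given by a balanced biadditive map. -/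
def liftAdd (ρ : RightAct R M) {G : Type u} [AddCommGroup G] (f : M → N → G)
    (hl : ∀ x y n, f (x + y) n = f x n + f y n) (hr : ∀ x n p, f x (n + p) = f x n + f x p)
    (hb : ∀ (r : R) x n, f (ρ (MulOpposite.op r) x) n = f x (r • n)) :
    Tens ρ N →+ G :=
  let F : M →+ N →+ G := AddMonoidHom.mk' (fun x => AddMonoidHom.mk' (f x) (hr x))
    (fun x y => AddMonoidHom.ext fun n => hl x y n)
  let F' : M ⊗[ℤ] N →+ G := TensorProduct.liftAddHom F (fun k x n => by
    rw [map_zsmul, map_zsmul]; rfl)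
  QuotientAddGroup.lift (tensRel ρ N).toAddSubgroup F' (by
    intro t ht
    have key : ∀ r : R, F' (r • t) = 0 := by
      refine Submodule.span_induction (p := fun t _ => ∀ r : R, F' (r • t) = 0)
        ?_ ?_ ?_ ?_ (show t ∈ tensRel ρ N from ht)
      · rintro t ⟨x, s, n, rfl⟩ r
        rw [smul_sub, TensorProduct.smul_tmul', TensorProduct.smul_tmul', map_sub, ← map_smul]
        exact sub_eq_zero.2 (hb s (r • x) n)
      · intro r; rw [smul_zero, map_zero]
      · intro s t _ _ hs ht r; rw [smul_add, map_add, hs r, ht r, add_zero]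
      · intro a t _ h r; rw [smul_smul]; exact h (r * a)
    simpa using key 1)

@[simp] theorem liftAdd_tmul (ρ : RightAct R M) {G : Type u} [AddCommGroup G] (f : M → N → G)
    (hl hr hb) (x : M) (n : N) : liftAdd ρ f hl hr hb (tmul ρ x n) = f x n := rfl

/-- The left linear map out of the tensor product given by a balanced biadditive map which is
linear in the first variable. -/
def lift (ρ : RightAct R M) (f : M → N → P)
    (hl : ∀ x y n, f (x + y) n = f x n + f y n) (hr : ∀ x n p, f x (n + p) = f x n + f x p)
    (hs : ∀ (r : R) x n, f (r • x) n = r • f x n)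
    (hb : ∀ (r : R) x n, f (ρ (MulOpposite.op r) x) n = f x (r • n)) :
    Tens ρ N →ₗ[R] P where
  toFun := liftAdd ρ f hl hr hb
  map_add' := map_add _
  map_smul' r t := by
    induction t using induction_on with
    | tmul x n => rw [← smul_tmul]; exact hs r x n
    | add s t hs ht => rw [smul_add, map_add, map_add, smul_add, hs, ht]

@[simp] theorem lift_tmul (ρ : RightAct R M) (f : M → N → P) (hl hr hs hb) (x : M) (n : N) :
    lift ρ f hl hr hs hb (tmul ρ x n) = f x n := rfl

/-- The map `f ⊗ g`. -/
def map {ρ : RightAct R M} {ρ' : RightAct R M'} (f : M →ₗ[R] M') (hf : Intertwines ρ ρ' f)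
    (g : N →ₗ[R] N') : Tens ρ N →ₗ[R] Tens ρ' N' :=
  lift ρ (fun x n => tmul ρ' (f x) (g n))
    (fun x y n => by rw [map_add, add_tmul])
    (fun x n p => by rw [map_add, tmul_add])
    (fun r x n => by rw [map_smul, smul_tmul])
    (fun r x n => by rw [hf, act_tmul, map_smul])

@[simp] theorem map_tmul {ρ : RightAct R M} {ρ' : RightAct R M'} (f : M →ₗ[R] M')
    (hf : Intertwines ρ ρ' f) (g : N →ₗ[R] N') (x : M) (n : N) :
    map f hf g (tmul ρ x n) = tmul ρ' (f x) (g n) := rfl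

/-- A right structure `σ` of `M` which is not used to form `M ⊗_R N` acts on `M ⊗_R N`. -/
def ofLeft (ρ σ : RightAct R M) [ActComm ρ σ] (N : Type u) [AddCommGroup N] [Module R N] :
    RightAct R (Tens ρ N) where
  toFun r := map (σ r) (ActComm.intertwines ρ σ r) LinearMap.id
  map_one' := hom_ext fun x n => by
    show tmul ρ (σ 1 x) n = tmul ρ x n
    rw [map_one]; rfl
  map_mul' r s := hom_ext fun x n => by
    show tmul ρ (σ (r * s) x) n = tmul ρ (σ r (σ s x)) n
    rw [map_mul]; rfl
  map_zero' := hom_ext fun x n => by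
    show tmul ρ (σ 0 x) n = 0
    rw [map_zero]; exact zero_tmul ρ n
  map_add' r s := hom_ext fun x n => by
    show tmul ρ (σ (r + s) x) n = tmul ρ (σ r x) n + tmul ρ (σ s x) n
    rw [map_add]; exact add_tmul ρ _ _ n

@[simp] theorem ofLeft_tmul (ρ σ : RightAct R M) [ActComm ρ σ] (r : Rᵐᵒᵖ) (x : M) (n : N) :
    ofLeft ρ σ N r (tmul ρ x n) = tmul ρ (σ r x) n := rfl

/-- A right structure of `N` acts on `M ⊗_R N`. -/
def ofRight (ρ : RightAct R M) (σ : RightAct R N) : RightAct R (Tens ρ N) where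
  toFun r := map LinearMap.id (Intertwines.id ρ) (σ r)
  map_one' := hom_ext fun x n => by
    show tmul ρ x (σ 1 n) = tmul ρ x n
    rw [map_one]; rfl
  map_mul' r s := hom_ext fun x n => by
    show tmul ρ x (σ (r * s) n) = tmul ρ x (σ r (σ s n))
    rw [map_mul]; rfl
  map_zero' := hom_ext fun x n => by
    show tmul ρ x (σ 0 n) = 0
    rw [map_zero]; exact tmul_zero ρ x
  map_add' r s := hom_ext fun x n => by
    show tmul ρ x (σ (r + s) n) = tmul ρ x (σ r n) + tmul ρ x (σ s n)
    rw [map_add]; exact tmul_add ρ x _ _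

@[simp] theorem ofRight_tmul (ρ : RightAct R M) (σ : RightAct R N) (r : Rᵐᵒᵖ) (x : M) (n : N) :
    ofRight ρ σ r (tmul ρ x n) = tmul ρ x (σ r n) := rfl

theorem intertwines_ext {ρ : RightAct R M} {σ : RightAct R (Tens ρ N)} {τ : RightAct R P}
    {f : Tens ρ N →ₗ[R] P} (h : ∀ r x n, f (σ r (tmul ρ x n)) = τ r (f (tmul ρ x n))) :
    Intertwines σ τ f := by
  intro r t
  have : f ∘ₗ σ r = τ r ∘ₗ f := hom_ext fun x n => h r x n
  exact LinearMap.congr_fun this t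

instance actComm_right_left (ρ σ : RightAct R M) [ActComm ρ σ] (τ : RightAct R N) :
    ActComm (ofRight ρ τ) (ofLeft ρ σ N) where
  comm r s t := by
    have : ofRight ρ τ r ∘ₗ ofLeft ρ σ N s = ofLeft ρ σ N s ∘ₗ ofRight ρ τ r :=
      hom_ext fun x n => by simp
    exact LinearMap.congr_fun this t

instance actComm_left_right (ρ σ : RightAct R M) [ActComm ρ σ] (τ : RightAct R N) :
    ActComm (ofLeft ρ σ N) (ofRight ρ τ) where
  comm r s t := (ActComm.comm s r t).symm

instance actComm_left_left (ρ σ τ : RightAct R M) [ActComm ρ σ] [ActComm ρ τ] [ActComm σ τ] :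
    ActComm (ofLeft ρ σ N) (ofLeft ρ τ N) where
  comm r s t := by
    have : ofLeft ρ σ N r ∘ₗ ofLeft ρ τ N s = ofLeft ρ τ N s ∘ₗ ofLeft ρ σ N r :=
      hom_ext fun x n => by simp [ActComm.comm (ρ := σ) (σ := τ)]
    exact LinearMap.congr_fun this t

instance actComm_right_right (ρ : RightAct R M) (σ τ : RightAct R N) [ActComm σ τ] :
    ActComm (ofRight ρ σ) (ofRight ρ τ) where
  comm r s t := by
    have : ofRight ρ σ r ∘ₗ ofRight ρ τ s = ofRight ρ τ s ∘ₗ ofRight ρ σ r :=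
      hom_ext fun x n => by simp [ActComm.comm (ρ := σ) (σ := τ)]
    exact LinearMap.congr_fun this t

theorem map_ofLeft {ρ σ : RightAct R M} [ActComm ρ σ] {ρ' σ' : RightAct R M'} [ActComm ρ' σ']
    {f : M →ₗ[R] M'} (hf : Intertwines ρ ρ' f) (hf' : Intertwines σ σ' f) (g : N →ₗ[R] N') :
    Intertwines (ofLeft ρ σ N) (ofLeft ρ' σ' N') (map f hf g) :=
  intertwines_ext fun r x n => by simp [hf' r x]

theorem map_ofRight {ρ : RightAct R M} {ρ' : RightAct R M'} {τ : RightAct R N}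
    {τ' : RightAct R N'} {f : M →ₗ[R] M'} (hf : Intertwines ρ ρ' f) {g : N →ₗ[R] N'}
    (hg : Intertwines τ τ' g) : Intertwines (ofRight ρ τ) (ofRight ρ' τ') (map f hf g) :=
  intertwines_ext fun r x n => by simp [hg r n]

/-- The map `(x ⊗ n) ⊗ p ↦ x ⊗ (n ⊗ p)`. -/
def assocHom (ρ : RightAct R M) (σ : RightAct R N) (P : Type u) [AddCommGroup P] [Module R P] :
    Tens (ofRight ρ σ) P →ₗ[R] Tens ρ (Tens σ P) :=
  lift (ofRight ρ σ)
    (fun t p => liftAdd ρ (fun x n => tmul ρ x (tmul σ n p))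
      (fun x y n => add_tmul ρ x y _)
      (fun x n n' => by rw [add_tmul, tmul_add])
      (fun r x n => by rw [act_tmul, smul_tmul]) t)
    (fun s t p => map_add _ s t)
    (fun t p q => by
      induction t using induction_on with
      | tmul x n => simp only [liftAdd_tmul, tmul_add]
      | add s t hs ht => simp only [map_add, hs, ht]; abel)
    (fun r t p => by
      induction t using induction_on with
      | tmul x n => rw [← smul_tmul ρ r x n]; exact smul_tmul ρ r x _
      | add s t hs ht => simp only [smul_add, map_add, hs, ht])
    (fun r t p => by
      induction t using induction_on with
      | tmul x n => rw [ofRight_tmul]; simp only [liftAdd_tmul, act_tmul]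
      | add s t hs ht => simp only [map_add, hs, ht])

theorem assocHom_tmul (ρ : RightAct R M) (σ : RightAct R N) (x : M) (n : N) (p : P) :
    assocHom ρ σ P (tmul (ofRight ρ σ) (tmul ρ x n) p) = tmul ρ x (tmul σ n p) := rfl

/-- The map `x ⊗ (n ⊗ p) ↦ (x ⊗ n) ⊗ p`. -/
def assocInv (ρ : RightAct R M) (σ : RightAct R N) (P : Type u) [AddCommGroup P] [Module R P] :
    Tens ρ (Tens σ P) →ₗ[R] Tens (ofRight ρ σ) P :=
  lift ρ
    (fun x s => liftAdd σ (fun n p => tmul (ofRight ρ σ) (tmul ρ x n) p)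
      (fun n n' p => by rw [tmul_add, add_tmul])
      (fun n p q => tmul_add _ _ p q)
      (fun r n p => by rw [← act_tmul, ofRight_tmul]) s)
    (fun x y s => by
      induction s using induction_on with
      | tmul n p => simp only [liftAdd_tmul, add_tmul]
      | add s t hs ht => simp only [map_add, hs, ht]; abel)
    (fun x s t => map_add _ s t)
    (fun r x s => by
      induction s using induction_on with
      | tmul n p => simp only [liftAdd_tmul, smul_tmul]
      | add s t hs ht => simp only [smul_add, map_add, hs, ht])
    (fun r x s => by
      induction s using induction_on with
      | tmul n p => rw [← smul_tmul]; simp only [liftAdd_tmul, act_tmul]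
      | add s t hs ht => simp only [smul_add, map_add, hs, ht])

theorem assocInv_tmul (ρ : RightAct R M) (σ : RightAct R N) (x : M) (n : N) (p : P) :
    assocInv ρ σ P (tmul ρ x (tmul σ n p)) = tmul (ofRight ρ σ) (tmul ρ x n) p := rfl

/-- The associativity isomorphism `(M ⊗ N) ⊗ P ≅ M ⊗ (N ⊗ P)`, where `P` is tensored to a
right structure of `N`. -/
def assoc (ρ : RightAct R M) (σ : RightAct R N) (P : Type u) [AddCommGroup P] [Module R P] :
    Tens (ofRight ρ σ) P ≃ₗ[R] Tens ρ (Tens σ P) :=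
  LinearEquiv.ofLinearMap (assocHom ρ σ P) (assocInv ρ σ P)
    (hom_ext fun x s => by
      induction s using induction_on with
      | tmul n p => rfl
      | add s t hs ht => rw [tmul_add, map_add, hs, ht]; rfl)
    (hom_ext fun t p => by
      induction t using induction_on with
      | tmul n p => rfl
      | add s t hs ht => rw [add_tmul, map_add, hs, ht]; rfl)

@[simp] theorem assoc_tmul (ρ : RightAct R M) (σ : RightAct R N) (x : M) (n : N) (p : P) :
    assoc ρ σ P (tmul (ofRight ρ σ) (tmul ρ x n) p) = tmul ρ x (tmul σ n p) := rfl

@[simp] theorem assoc_symm_tmul (ρ : RightAct R M) (σ : RightAct R N) (x : M) (n : N) (p : P) :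
    (assoc ρ σ P).symm (tmul ρ x (tmul σ n p)) = tmul (ofRight ρ σ) (tmul ρ x n) p := rfl

/-- The map `(x ⊗ n) ⊗ p ↦ (x ⊗ p) ⊗ n`. -/
def swapHom (ρ σ : RightAct R M) [ActComm ρ σ] [ActComm σ ρ] (N P : Type u)
    [AddCommGroup N] [Module R N] [AddCommGroup P] [Module R P] :
    Tens (ofLeft ρ σ N) P →ₗ[R] Tens (ofLeft σ ρ P) N :=
  lift (ofLeft ρ σ N)
    (fun t p => liftAdd ρ (fun x n => tmul (ofLeft σ ρ P) (tmul σ x p) n)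
      (fun x y n => by rw [add_tmul, add_tmul])
      (fun x n n' => tmul_add _ _ n n')
      (fun r x n => by rw [← act_tmul, ofLeft_tmul]) t)
    (fun s t p => map_add _ s t)
    (fun t p q => by
      induction t using induction_on with
      | tmul x n => simp only [liftAdd_tmul, tmul_add, add_tmul]
      | add s t hs ht => simp only [map_add, hs, ht]; abel)
    (fun r t p => by
      induction t using induction_on with
      | tmul x n =>
        rw [← smul_tmul ρ r x n]; simp only [liftAdd_tmul]; rw [smul_tmul, smul_tmul]
      | add s t hs ht => simp only [smul_add, map_add, hs, ht])
    (fun r t p => by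
      induction t using induction_on with
      | tmul x n => rw [ofLeft_tmul]; simp only [liftAdd_tmul, act_tmul]
      | add s t hs ht => simp only [map_add, hs, ht])

theorem swapHom_tmul (ρ σ : RightAct R M) [ActComm ρ σ] [ActComm σ ρ] (x : M) (n : N)
    (p : P) : swapHom ρ σ N P (tmul (ofLeft ρ σ N) (tmul ρ x n) p) =
      tmul (ofLeft σ ρ P) (tmul σ x p) n := rfl

theorem swapHom_swapHom (ρ σ : RightAct R M) [ActComm ρ σ] [ActComm σ ρ] (N P : Type u)
    [AddCommGroup N] [Module R N] [AddCommGroup P] [Module R P] :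
    (swapHom σ ρ P N).comp (swapHom ρ σ N P) = LinearMap.id :=
  hom_ext fun t p => by
    induction t using induction_on with
    | tmul n p => rfl
    | add s t hs ht => rw [add_tmul, map_add, hs, ht]; rfl

/-- The isomorphism `(M ⊗ N) ⊗ P ≅ (M ⊗ P) ⊗ N` for two commuting right structures `ρ`, `σ`
of `M`, where `N` is tensored to `ρ` and `P` to `σ`: a permutation of tensor factors. -/
def swap (ρ σ : RightAct R M) [ActComm ρ σ] [ActComm σ ρ] (N P : Type u)
    [AddCommGroup N] [Module R N] [AddCommGroup P] [Module R P] :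
    Tens (ofLeft ρ σ N) P ≃ₗ[R] Tens (ofLeft σ ρ P) N :=
  LinearEquiv.ofLinearMap (swapHom ρ σ N P) (swapHom σ ρ P N)
    (swapHom_swapHom σ ρ P N) (swapHom_swapHom ρ σ N P)

@[simp] theorem swap_tmul (ρ σ : RightAct R M) [ActComm ρ σ] [ActComm σ ρ] (x : M) (n : N)
    (p : P) : swap ρ σ N P (tmul (ofLeft ρ σ N) (tmul ρ x n) p) =
      tmul (ofLeft σ ρ P) (tmul σ x p) n := rfl

/-- Right multiplication on `R`. -/
def mulRight (R : Type u) [Ring R] : RightAct R R where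
  toFun r := LinearMap.toSpanSingleton R R r.unop
  map_one' := LinearMap.ext fun x => by simp
  map_mul' r s := LinearMap.ext fun x => by simp [mul_assoc]
  map_zero' := LinearMap.ext fun x => by simp
  map_add' r s := LinearMap.ext fun x => by simp [mul_add]

@[simp] theorem mulRight_apply (r : Rᵐᵒᵖ) (x : R) : mulRight R r x = x * r.unop := rfl

/-- The isomorphism `M ⊗ R ≅ M`, `x ⊗ r ↦ x ⊙ r`. -/
def rid (ρ : RightAct R M) : Tens ρ R ≃ₗ[R] M :=
  LinearEquiv.ofLinearMap
    (lift ρ (fun x (r : R) => ρ (MulOpposite.op r) x)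
      (fun x y r => map_add _ _ _)
      (fun x r s => by rw [MulOpposite.op_add, map_add]; rfl)
      (fun a x r => map_smul _ _ _)
      (fun r x s => by rw [smul_eq_mul, MulOpposite.op_mul, map_mul]; rfl))
    { toFun := fun x => tmul ρ x (1 : R)
      map_add' := fun x y => add_tmul ρ x y 1
      map_smul' := fun r x => smul_tmul ρ r x 1 }
    (LinearMap.ext fun x => by
      show ρ (MulOpposite.op 1) x = x
      rw [MulOpposite.op_one, map_one]; rfl)
    (hom_ext fun x r => by
      show tmul ρ (ρ (MulOpposite.op r) x) 1 = tmul ρ x r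
      rw [act_tmul, smul_eq_mul, mul_one])

@[simp] theorem rid_tmul (ρ : RightAct R M) (x : M) (r : R) :
    rid ρ (tmul ρ x r) = ρ (MulOpposite.op r) x := rfl

@[simp] theorem rid_symm_apply (ρ : RightAct R M) (x : M) :
    (rid ρ).symm x = tmul ρ x (1 : R) := rfl

/-- The isomorphism `R ⊗ N ≅ N`, `r ⊗ n ↦ r n`. -/
def lid (N : Type u) [AddCommGroup N] [Module R N] : Tens (mulRight R) N ≃ₗ[R] N :=
  LinearEquiv.ofLinearMap
    (lift (mulRight R) (fun (r : R) (n : N) => r • n)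
      (fun r s n => add_smul r s n)
      (fun r n p => smul_add r n p)
      (fun a r n => mul_smul a r n)
      (fun r x n => mul_smul x r n))
    { toFun := fun n => tmul (mulRight R) (1 : R) n
      map_add' := fun n p => tmul_add _ 1 n p
      map_smul' := fun r n => by
        rw [← act_tmul, RingHom.id_apply, ← smul_tmul]; simp }
    (LinearMap.ext fun n => one_smul R n)
    (hom_ext fun r n => by
      show tmul (mulRight R) (1 : R) (r • n) = tmul (mulRight R) r n
      rw [← act_tmul]; simp)

@[simp] theorem lid_tmul (r : R) (n : N) : lid N (tmul (mulRight R) r n) = r • n := rfl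

end

end Tens

/-! ## Bimodules and 2-fold bimodules -/

/-- An `R`-bimodule: a left `R`-module with a commuting right structure. -/
structure Bimodule (R : Type u) [Ring R] where
  carrier : Type u
  [addCommGroup : AddCommGroup carrier]
  [module : Module R carrier]
  act : RightAct R carrier

/-- A 2-fold bimodule: a left `R`-module with two commuting right structures. -/
structure TwoBimodule (R : Type u) [Ring R] where
  carrier : Type u
  [addCommGroup : AddCommGroup carrier]
  [module : Module R carrier]
  act₁ : RightAct R carrier
  act₂ : RightAct R carrier
  comm : ActComm act₁ act₂

attribute [instance] Bimodule.addCommGroup Bimodule.module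
attribute [instance] TwoBimodule.addCommGroup TwoBimodule.module TwoBimodule.comm

instance (R : Type u) [Ring R] : CoeSort (Bimodule R) (Type u) := ⟨Bimodule.carrier⟩
instance (R : Type u) [Ring R] : CoeSort (TwoBimodule R) (Type u) := ⟨TwoBimodule.carrier⟩

instance {R : Type u} [Ring R] (Λ : TwoBimodule R) : ActComm Λ.act₂ Λ.act₁ where
  comm r s x := (ActComm.comm s r x).symm

namespace TwoBimodule

section

open Tens

variable {R : Type u} [Ring R] (Λ : TwoBimodule R)

/-- The tensor product `Λ_{B,A} ⊗ A ⊗ B`: the factor `A` is tensored to the second right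
structure of `Λ`, the factor `B` to the first one. -/
abbrev prod (A B : Type u) [AddCommGroup A] [Module R A] [AddCommGroup B] [Module R B] :
    Type u :=
  Tens (ofLeft Λ.act₂ Λ.act₁ A) B

variable {A A' B B' : Type u} [AddCommGroup A] [Module R A] [AddCommGroup B] [Module R B]
  [AddCommGroup A'] [Module R A'] [AddCommGroup B'] [Module R B']

/-- The element `x ⊗ a ⊗ b` of `Λ_{B,A} ⊗ A ⊗ B`. -/
def tmul₂ (x : Λ) (a : A) (b : B) : Λ.prod A B := tmul (ofLeft Λ.act₂ Λ.act₁ A) (tmul Λ.act₂ x a) b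

/-- The map `1 ⊗ f ⊗ g`. -/
def prodMap (f : A →ₗ[R] A') (g : B →ₗ[R] B') : Λ.prod A B →ₗ[R] Λ.prod A' B' :=
  map (map LinearMap.id (Intertwines.id _) f) (map_ofLeft _ (Intertwines.id _) _) g

@[simp] theorem prodMap_tmul (f : A →ₗ[R] A') (g : B →ₗ[R] B') (x : Λ) (a : A) (b : B) :
    Λ.prodMap f g (tmul (ofLeft Λ.act₂ Λ.act₁ A) (tmul Λ.act₂ x a) b) =
      tmul (ofLeft Λ.act₂ Λ.act₁ A') (tmul Λ.act₂ x (f a)) (g b) := rfl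

theorem prod_hom_ext {P : Type u} [AddCommGroup P] [Module R P] {f g : Λ.prod A B →ₗ[R] P}
    (h : ∀ x a b, f (tmul (ofLeft Λ.act₂ Λ.act₁ A) (tmul Λ.act₂ x a) b) =
      g (tmul (ofLeft Λ.act₂ Λ.act₁ A) (tmul Λ.act₂ x a) b)) : f = g :=
  hom_ext fun t b => by
    induction t using induction_on with
    | tmul x a => exact h x a b
    | add s t hs ht => rw [add_tmul, map_add, map_add, hs, ht]

/-- The right structure of `Λ_{B,A} ⊗ A ⊗ B` coming from a right structure of `A`. -/
abbrev actFst (σ : RightAct R A) (B : Type u) [AddCommGroup B] [Module R B] :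
    RightAct R (Λ.prod A B) :=
  ofLeft (ofLeft Λ.act₂ Λ.act₁ A) (ofRight Λ.act₂ σ) B

/-- The right structure of `Λ_{B,A} ⊗ A ⊗ B` coming from a right structure of `B`. -/
abbrev actSnd (A : Type u) [AddCommGroup A] [Module R A] (τ : RightAct R B) :
    RightAct R (Λ.prod A B) :=
  ofRight (ofLeft Λ.act₂ Λ.act₁ A) τ

/-- The permutation `Λ_{B,A} ⊗ (A ⊗ N) ⊗ B → (Λ_{B,A} ⊗ A ⊗ B) ⊗ N`,
`x ⊗ (a ⊗ n) ⊗ b ↦ (x ⊗ a ⊗ b) ⊗ n`. -/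
def pullFst (σ : RightAct R A) (N B : Type u) [AddCommGroup N] [Module R N]
    [AddCommGroup B] [Module R B] :
    Λ.prod (Tens σ N) B →ₗ[R] Tens (Λ.actFst σ B) N :=
  (swap (ofRight Λ.act₂ σ) (ofLeft Λ.act₂ Λ.act₁ A) N B).toLinearMap ∘ₗ
    map (ρ' := ofLeft (ofRight Λ.act₂ σ) (ofLeft Λ.act₂ Λ.act₁ A) N)
      (assoc Λ.act₂ σ N).symm.toLinearMap
      (Intertwines.symm (e := assoc Λ.act₂ σ N) (fun r t => by
        have : (assoc Λ.act₂ σ N).toLinearMap ∘ₗ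
            ofLeft (ofRight Λ.act₂ σ) (ofLeft Λ.act₂ Λ.act₁ A) N r =
            ofLeft Λ.act₂ Λ.act₁ (Tens σ N) r ∘ₗ (assoc Λ.act₂ σ N).toLinearMap :=
          hom_ext fun s n => by
            induction s using induction_on with
            | tmul x a => rfl
            | add s t hs ht => rw [add_tmul, map_add, map_add, hs, ht]
        exact LinearMap.congr_fun this t))
      LinearMap.id

theorem pullFst_tmul (σ : RightAct R A) {N : Type u} [AddCommGroup N] [Module R N]
    (x : Λ) (a : A) (n : N) (b : B) :
    Λ.pullFst σ N B (Λ.tmul₂ x (tmul σ a n) b) =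
      tmul (Λ.actFst σ B) (Λ.tmul₂ x a b) n := rfl

/-- The associativity `Λ_{B,A} ⊗ A ⊗ (B ⊗ N) → (Λ_{B,A} ⊗ A ⊗ B) ⊗ N`. -/
def pullSnd (A : Type u) [AddCommGroup A] [Module R A] (τ : RightAct R B) (N : Type u)
    [AddCommGroup N] [Module R N] :
    Λ.prod A (Tens τ N) →ₗ[R] Tens (Λ.actSnd A τ) N :=
  (assoc (ofLeft Λ.act₂ Λ.act₁ A) τ N).symm.toLinearMap

theorem pullSnd_tmul (τ : RightAct R B) {N : Type u} [AddCommGroup N] [Module R N]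
    (x : Λ) (a : A) (b : B) (n : N) :
    Λ.pullSnd A τ N (Λ.tmul₂ x a (tmul τ b n)) =
      tmul (Λ.actSnd A τ) (Λ.tmul₂ x a b) n := rfl

theorem pullFst_actSnd (σ : RightAct R A) (N : Type u) [AddCommGroup N] [Module R N]
    (τ : RightAct R B) :
    Intertwines (Λ.actSnd (Tens σ N) τ) (ofLeft (Λ.actFst σ B) (Λ.actSnd A τ) N)
      (Λ.pullFst σ N B) := by
  intro r t
  have : Λ.pullFst σ N B ∘ₗ Λ.actSnd (Tens σ N) τ r =
      ofLeft (Λ.actFst σ B) (Λ.actSnd A τ) N r ∘ₗ Λ.pullFst σ N B :=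
    prod_hom_ext _ fun x s b => by
      induction s using induction_on with
      | tmul a n => rfl
      | add s t hs ht => rw [tmul_add, add_tmul, map_add, map_add, hs, ht]
  exact LinearMap.congr_fun this t

/-- The isomorphism `Λ ≅ Λ_{B,A} ⊗ R ⊗ R`, `x ↦ x ⊗ 1 ⊗ 1`. -/
def unitProd : Λ ≃ₗ[R] Λ.prod R R :=
  (rid Λ.act₂).symm.trans (rid (ofLeft Λ.act₂ Λ.act₁ R)).symm

theorem unitProd_apply (x : Λ) : Λ.unitProd x = Λ.tmul₂ x (1 : R) (1 : R) := rfl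

theorem unitProd_act₁ (r : Rᵐᵒᵖ) (x : Λ) :
    Λ.unitProd (Λ.act₁ r x) = Λ.prodMap LinearMap.id (mulRight R r) (Λ.unitProd x) := by
  show tmul _ (ofLeft Λ.act₂ Λ.act₁ R r (tmul Λ.act₂ x 1)) (1 : R) =
    tmul _ (tmul Λ.act₂ x 1) ((1 : R) * r.unop)
  rw [← MulOpposite.op_unop r, act_tmul]; simp

theorem unitProd_act₂ (r : Rᵐᵒᵖ) (x : Λ) :
    Λ.unitProd (Λ.act₂ r x) = Λ.prodMap (mulRight R r) LinearMap.id (Λ.unitProd x) := by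
  show tmul _ (tmul Λ.act₂ (Λ.act₂ r x) 1) (1 : R) =
    tmul _ (tmul Λ.act₂ x ((1 : R) * r.unop)) (1 : R)
  rw [← MulOpposite.op_unop r, act_tmul]; simp

theorem tmul_one_act₁ (r : Rᵐᵒᵖ) (t : Tens Λ.act₂ A) :
    tmul (ofLeft Λ.act₂ Λ.act₁ A) (ofLeft Λ.act₂ Λ.act₁ A r t) (1 : R) =
      Λ.prodMap LinearMap.id (mulRight R r) (tmul (ofLeft Λ.act₂ Λ.act₁ A) t (1 : R)) := by
  rw [← MulOpposite.op_unop r, act_tmul]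
  induction t using induction_on with
  | tmul x a => simp
  | add s t hs ht => rw [add_tmul, add_tmul, map_add, hs, ht]

theorem unitProd_symm_act₁ (r : Rᵐᵒᵖ) (t : Λ.prod R R) :
    Λ.unitProd.symm (Λ.prodMap LinearMap.id (mulRight R r) t) =
      Λ.act₁ r (Λ.unitProd.symm t) := by
  rw [LinearEquiv.symm_apply_eq, unitProd_act₁, LinearEquiv.apply_symm_apply]

theorem unitProd_symm_act₂ (r : Rᵐᵒᵖ) (t : Λ.prod R R) :
    Λ.unitProd.symm (Λ.prodMap (mulRight R r) LinearMap.id t) =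
      Λ.act₂ r (Λ.unitProd.symm t) := by
  rw [LinearEquiv.symm_apply_eq, unitProd_act₂, LinearEquiv.apply_symm_apply]

theorem prodMap_id : Λ.prodMap (LinearMap.id : A →ₗ[R] A) (LinearMap.id : B →ₗ[R] B) =
    LinearMap.id :=
  prod_hom_ext _ fun _ _ _ => rfl

end

end TwoBimodule

/-! ## Additive symmetric monoidal structures represented by 2-fold bimodules -/

/-- An additive symmetric monoidal structure on the category of left `R`-modules. -/
structure AddSymMon (R : Type u) [Ring R] where
  [monoidal : MonoidalCategory (ModuleCat.{u} R)]
  [symmetric : SymmetricCategory (ModuleCat.{u} R)]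
  [additive : MonoidalPreadditive (ModuleCat.{u} R)]

namespace AddSymMon

section

variable {R : Type u} [Ring R] (W : AddSymMon R)

/-- The category of left `R`-modules, endowed with the symmetric monoidal structure `W`. -/
def Cat (_ : AddSymMon R) : Type (u + 1) := ModuleCat.{u} R

instance : Category.{u} W.Cat := inferInstanceAs (Category.{u} (ModuleCat.{u} R))
instance : Preadditive W.Cat := inferInstanceAs (Preadditive (ModuleCat.{u} R))
instance : MonoidalCategory W.Cat := W.monoidal
instance : SymmetricCategory W.Cat := W.symmetric
instance : MonoidalPreadditive W.Cat := W.additive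

/-- A left `R`-module as an object of `W.Cat`. -/
def of (A : Type u) [AddCommGroup A] [Module R A] : W.Cat := ModuleCat.of R A

/-- The underlying left `R`-module of an object of `W.Cat`. -/
def mod (A : W.Cat) : ModuleCat.{u} R := A

/-- A left linear map as a morphism of `W.Cat`. -/
def ofHom {A B : Type u} [AddCommGroup A] [Module R A] [AddCommGroup B] [Module R B]
    (f : A →ₗ[R] B) : W.of A ⟶ W.of B := ModuleCat.ofHom f

/-- A morphism of `W.Cat` as a left linear map. -/
def lin {A B : W.Cat} (f : A ⟶ B) : W.mod A →ₗ[R] W.mod B := ModuleCat.Hom.hom (R := R) f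

theorem lin_comp {A B C : W.Cat} (f : A ⟶ B) (g : B ⟶ C) :
    W.lin (f ≫ g) = W.lin g ∘ₗ W.lin f := rfl

variable (A B C : Type u) [AddCommGroup A] [Module R A] [AddCommGroup B] [Module R B]
  [AddCommGroup C] [Module R C]

/-- The monoidal product of two left `R`-modules. -/
def tens : ModuleCat.{u} R := W.mod (W.of A ⊗ W.of B)

/-- The unit of the monoidal structure. -/
def unit : ModuleCat.{u} R := W.mod (𝟙_ W.Cat)

/-- The commutativity isomorphism. -/
def braid : W.tens A B →ₗ[R] W.tens B A := W.lin (β_ (W.of A) (W.of B)).hom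

/-- The associativity isomorphism. -/
def assoc : W.tens (W.tens A B) C →ₗ[R] W.tens A (W.tens B C) :=
  W.lin (α_ (W.of A) (W.of B) (W.of C)).hom

/-- The left unit isomorphism. -/
def leftUnit : W.tens W.unit B →ₗ[R] B := W.lin (λ_ (W.of B)).hom

variable {A B C}
variable {A' B' C' : Type u} [AddCommGroup A'] [Module R A'] [AddCommGroup B'] [Module R B']
  [AddCommGroup C'] [Module R C']

/-- The monoidal product of two left linear maps. -/
def tensMap (f : A →ₗ[R] A') (g : B →ₗ[R] B') : W.tens A B →ₗ[R] W.tens A' B' :=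
  W.lin (W.ofHom f ⊗ₘ W.ofHom g)

theorem braid_natural (f : A →ₗ[R] A') (g : B →ₗ[R] B') :
    W.braid A' B' ∘ₗ W.tensMap f g = W.tensMap g f ∘ₗ W.braid A B :=
  congrArg W.lin (BraidedCategory.braiding_naturality (W.ofHom f) (W.ofHom g))

theorem assoc_natural (f : A →ₗ[R] A') (g : B →ₗ[R] B') (h : C →ₗ[R] C') :
    W.assoc A' B' C' ∘ₗ W.tensMap (W.tensMap f g) h =
      W.tensMap f (W.tensMap g h) ∘ₗ W.assoc A B C :=
  congrArg W.lin (MonoidalCategory.associator_naturality (W.ofHom f) (W.ofHom g) (W.ofHom h))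

theorem leftUnit_natural (g : B →ₗ[R] B') :
    W.leftUnit B' ∘ₗ W.tensMap LinearMap.id g = g ∘ₗ W.leftUnit B := by
  have h := MonoidalCategory.leftUnitor_naturality (C := W.Cat) (W.ofHom g)
  rw [← MonoidalCategory.id_tensorHom] at h
  exact congrArg W.lin h

theorem tensMap_comp {A'' B'' : Type u} [AddCommGroup A''] [Module R A''] [AddCommGroup B'']
    [Module R B''] (f : A →ₗ[R] A') (g : B →ₗ[R] B') (f' : A' →ₗ[R] A'') (g' : B' →ₗ[R] B'') :
    W.tensMap f' g' ∘ₗ W.tensMap f g = W.tensMap (f' ∘ₗ f) (g' ∘ₗ g) :=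
  congrArg W.lin (MonoidalCategory.tensorHom_comp_tensorHom (C := W.Cat)
    (W.ofHom f) (W.ofHom g) (W.ofHom f') (W.ofHom g'))

end

end AddSymMon

/-- A representation of the monoidal product `∧` of `W` by a 2-fold bimodule `Λ`: an isomorphism
`Λ_{B,A} ⊗ A ⊗ B ≅ A ∧ B`, natural in `A` and `B`. -/
structure AddSymMon.Rep {R : Type u} [Ring R] (W : AddSymMon R) where
  bimod : TwoBimodule R
  iso (A B : Type u) [AddCommGroup A] [Module R A] [AddCommGroup B] [Module R B] :
    bimod.prod A B ≃ₗ[R] W.tens A B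
  natural {A A' B B' : Type u} [AddCommGroup A] [Module R A] [AddCommGroup B] [Module R B]
    [AddCommGroup A'] [Module R A'] [AddCommGroup B'] [Module R B']
    (f : A →ₗ[R] A') (g : B →ₗ[R] B') (t : bimod.prod A B) :
    iso A' B' (bimod.prodMap f g t) = W.tensMap f g (iso A B t)

namespace AddSymMon.Rep

section

open Tens

variable {R : Type u} [Ring R] {W : AddSymMon R} (Λ : W.Rep)

theorem symm_natural {A A' B B' : Type u} [AddCommGroup A] [Module R A] [AddCommGroup B]
    [Module R B] [AddCommGroup A'] [Module R A'] [AddCommGroup B'] [Module R B']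
    (f : A →ₗ[R] A') (g : B →ₗ[R] B') (t : W.tens A B) :
    (Λ.iso A' B').symm (W.tensMap f g t) = Λ.bimod.prodMap f g ((Λ.iso A B).symm t) := by
  rw [LinearEquiv.symm_apply_eq, Λ.natural, LinearEquiv.apply_symm_apply]

/-- The commutativity isomorphism `c : Λ_{B,A} → Λ_{A,B}`, which is the commutativity isomorphism
`R ∧ R → R ∧ R` read through `Λ ≅ Λ ⊗ R ⊗ R ≅ R ∧ R`. -/
def c : Λ.bimod →ₗ[R] Λ.bimod :=
  Λ.bimod.unitProd.symm.toLinearMap ∘ₗ (Λ.iso R R).symm.toLinearMap ∘ₗ W.braid R R ∘ₗ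
    (Λ.iso R R).toLinearMap ∘ₗ Λ.bimod.unitProd.toLinearMap

theorem c_act₁ : Intertwines Λ.bimod.act₁ Λ.bimod.act₂ Λ.c := by
  intro r x
  show Λ.bimod.unitProd.symm ((Λ.iso R R).symm (W.braid R R (Λ.iso R R
      (Λ.bimod.unitProd (Λ.bimod.act₁ r x))))) = _
  have := LinearMap.congr_fun (W.braid_natural (LinearMap.id : R →ₗ[R] R) (mulRight R r))
    (Λ.iso R R (Λ.bimod.unitProd x))
  simp only [LinearMap.comp_apply] at this
  rw [Λ.bimod.unitProd_act₁, Λ.natural, this, Λ.symm_natural, LinearEquiv.symm_apply_eq,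
    Λ.bimod.unitProd_act₂]
  simp [c]

theorem c_act₂ : Intertwines Λ.bimod.act₂ Λ.bimod.act₁ Λ.c := by
  intro r x
  show Λ.bimod.unitProd.symm ((Λ.iso R R).symm (W.braid R R (Λ.iso R R
      (Λ.bimod.unitProd (Λ.bimod.act₂ r x))))) = _
  have := LinearMap.congr_fun (W.braid_natural (mulRight R r) (LinearMap.id : R →ₗ[R] R))
    (Λ.iso R R (Λ.bimod.unitProd x))
  simp only [LinearMap.comp_apply] at this
  rw [Λ.bimod.unitProd_act₂, Λ.natural, this, Λ.symm_natural, LinearEquiv.symm_apply_eq,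
    Λ.bimod.unitProd_act₁]
  simp [c]

/-- The unit isomorphism `ℓ : Λ_{B,K} ⊗ K → R_B`, which is the left unit isomorphism
`K ∧ R → R` read through `Λ_{B,K} ⊗ K ≅ Λ_{B,K} ⊗ K ⊗ R ≅ K ∧ R`. -/
def l : Tens Λ.bimod.act₂ W.unit →ₗ[R] R :=
  W.leftUnit R ∘ₗ (Λ.iso W.unit R).toLinearMap ∘ₗ
    (rid (ofLeft Λ.bimod.act₂ Λ.bimod.act₁ W.unit)).symm.toLinearMap

theorem l_act : Intertwines (ofLeft Λ.bimod.act₂ Λ.bimod.act₁ W.unit) (mulRight R) Λ.l := by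
  intro r t
  have h2 := LinearMap.congr_fun (W.leftUnit_natural (mulRight R r))
    (Λ.iso W.unit R (tmul (ofLeft Λ.bimod.act₂ Λ.bimod.act₁ W.unit) t (1 : R)))
  simp only [LinearMap.comp_apply] at h2
  show W.leftUnit R (Λ.iso W.unit R (tmul _ (ofLeft Λ.bimod.act₂ Λ.bimod.act₁ W.unit r t) (1 : R)))
    = _
  rw [Λ.bimod.tmul_one_act₁, Λ.natural, h2]
  rfl

/-- The isomorphism `Λ_{C,Λ} ⊗ Λ_{B,A} → (R ∧ R) ∧ R`. -/
def tripleLeft : Tens Λ.bimod.act₂ Λ.bimod →ₗ[R] W.tens (W.tens R R) R :=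
  (Λ.iso (W.tens R R) R).toLinearMap ∘ₗ
    Λ.bimod.prodMap (Λ.iso R R).toLinearMap LinearMap.id ∘ₗ
    Λ.bimod.prodMap Λ.bimod.unitProd.toLinearMap LinearMap.id ∘ₗ
    (rid (ofLeft Λ.bimod.act₂ Λ.bimod.act₁ Λ.bimod)).symm.toLinearMap

/-- The isomorphism `R ∧ (R ∧ R) → Λ_{Λ,A} ⊗ Λ_{C,B}`. -/
def tripleRight : W.tens R (W.tens R R) →ₗ[R] Tens Λ.bimod.act₁ Λ.bimod :=
  map (rid Λ.bimod.act₂).toLinearMap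
      (intertwines_ext fun r x s =>
        (ActComm.comm (ρ := Λ.bimod.act₂) (σ := Λ.bimod.act₁) (MulOpposite.op s) r x))
      Λ.bimod.unitProd.symm.toLinearMap ∘ₗ
    Λ.bimod.prodMap LinearMap.id (Λ.iso R R).symm.toLinearMap ∘ₗ
    (Λ.iso R (W.tens R R)).symm.toLinearMap

/-- The associativity isomorphism `a : Λ_{C,Λ} ⊗ Λ_{B,A} → Λ_{Λ,A} ⊗ Λ_{C,B}`, which is the
associativity isomorphism `(R ∧ R) ∧ R → R ∧ (R ∧ R)` read through the representation. -/
def a : Tens Λ.bimod.act₂ Λ.bimod →ₗ[R] Tens Λ.bimod.act₁ Λ.bimod :=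
  Λ.tripleRight ∘ₗ W.assoc R R R ∘ₗ Λ.tripleLeft

theorem tripleLeft_A (r : Rᵐᵒᵖ) (t : Tens Λ.bimod.act₂ Λ.bimod) :
    Λ.tripleLeft (ofRight Λ.bimod.act₂ Λ.bimod.act₂ r t) =
      W.tensMap (W.tensMap (mulRight R r) LinearMap.id) LinearMap.id (Λ.tripleLeft t) := by
  simp only [tripleLeft, LinearMap.comp_apply, LinearEquiv.coe_coe, ← Λ.natural]
  congr 1
  induction t using induction_on with
  | tmul x y => simp [Λ.bimod.unitProd_act₂, Λ.natural]
  | add s t hs ht => simp only [map_add, hs, ht]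

theorem tripleLeft_B (r : Rᵐᵒᵖ) (t : Tens Λ.bimod.act₂ Λ.bimod) :
    Λ.tripleLeft (ofRight Λ.bimod.act₂ Λ.bimod.act₁ r t) =
      W.tensMap (W.tensMap LinearMap.id (mulRight R r)) LinearMap.id (Λ.tripleLeft t) := by
  simp only [tripleLeft, LinearMap.comp_apply, LinearEquiv.coe_coe, ← Λ.natural]
  congr 1
  induction t using induction_on with
  | tmul x y => simp [Λ.bimod.unitProd_act₁, Λ.natural]
  | add s t hs ht => simp only [map_add, hs, ht]

theorem tripleLeft_C (r : Rᵐᵒᵖ) (t : Tens Λ.bimod.act₂ Λ.bimod) :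
    Λ.tripleLeft (ofLeft Λ.bimod.act₂ Λ.bimod.act₁ Λ.bimod r t) =
      W.tensMap (W.tensMap LinearMap.id LinearMap.id) (mulRight R r) (Λ.tripleLeft t) := by
  simp only [tripleLeft, LinearMap.comp_apply, LinearEquiv.coe_coe, ← Λ.natural, rid_symm_apply,
    Λ.bimod.tmul_one_act₁]
  congr 1
  induction t using induction_on with
  | tmul x y => simp [← Λ.natural, TwoBimodule.prodMap_id]
  | add s t hs ht => simp only [add_tmul, map_add, hs, ht]

/-- The part of `tripleRight` which does not involve the representation. -/
def tripleRightAux : Λ.bimod.prod R (Λ.bimod.prod R R) →ₗ[R] Tens Λ.bimod.act₁ Λ.bimod :=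
  map (rid Λ.bimod.act₂).toLinearMap
      (intertwines_ext fun r x s =>
        (ActComm.comm (ρ := Λ.bimod.act₂) (σ := Λ.bimod.act₁) (MulOpposite.op s) r x))
      Λ.bimod.unitProd.symm.toLinearMap

theorem tripleRight_natural (f g h : R →ₗ[R] R) (t : W.tens R (W.tens R R)) :
    Λ.tripleRight (W.tensMap f (W.tensMap g h) t) =
      Λ.tripleRightAux (Λ.bimod.prodMap f (Λ.bimod.prodMap g h)
        (Λ.bimod.prodMap LinearMap.id (Λ.iso R R).symm.toLinearMap
          ((Λ.iso R (W.tens R R)).symm t))) := by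
  show Λ.tripleRightAux (Λ.bimod.prodMap LinearMap.id (Λ.iso R R).symm.toLinearMap
    ((Λ.iso R (W.tens R R)).symm (W.tensMap f (W.tensMap g h) t))) = _
  rw [Λ.symm_natural]
  congr 1
  generalize (Λ.iso R (W.tens R R)).symm t = s
  induction s using induction_on with
  | tmul s b =>
    induction s using induction_on with
    | tmul x a => simp [Λ.symm_natural]
    | add s t hs ht => simp only [add_tmul, map_add, hs, ht]
  | add s t hs ht => simp only [map_add, hs, ht]

theorem tripleRight_A (r : Rᵐᵒᵖ) (t : W.tens R (W.tens R R)) :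
    Λ.tripleRight (W.tensMap (mulRight R r) (W.tensMap LinearMap.id LinearMap.id) t) =
      ofLeft Λ.bimod.act₁ Λ.bimod.act₂ Λ.bimod r (Λ.tripleRight t) := by
  rw [tripleRight_natural]
  show _ = ofLeft Λ.bimod.act₁ Λ.bimod.act₂ Λ.bimod r (Λ.tripleRightAux
    (Λ.bimod.prodMap LinearMap.id (Λ.iso R R).symm.toLinearMap ((Λ.iso R (W.tens R R)).symm t)))
  generalize Λ.bimod.prodMap LinearMap.id (Λ.iso R R).symm.toLinearMap
    ((Λ.iso R (W.tens R R)).symm t) = s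
  induction s using induction_on with
  | tmul s b =>
    induction s using induction_on with
    | tmul x a => simp [tripleRightAux, TwoBimodule.prodMap_id]
    | add s t hs ht => simp only [add_tmul, map_add, hs, ht]
  | add s t hs ht => simp only [map_add, hs, ht]

theorem tripleRight_B (r : Rᵐᵒᵖ) (t : W.tens R (W.tens R R)) :
    Λ.tripleRight (W.tensMap LinearMap.id (W.tensMap (mulRight R r) LinearMap.id) t) =
      ofRight Λ.bimod.act₁ Λ.bimod.act₂ r (Λ.tripleRight t) := by
  rw [tripleRight_natural]
  show _ = ofRight Λ.bimod.act₁ Λ.bimod.act₂ r (Λ.tripleRightAux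
    (Λ.bimod.prodMap LinearMap.id (Λ.iso R R).symm.toLinearMap ((Λ.iso R (W.tens R R)).symm t)))
  generalize Λ.bimod.prodMap LinearMap.id (Λ.iso R R).symm.toLinearMap
    ((Λ.iso R (W.tens R R)).symm t) = s
  induction s using induction_on with
  | tmul s b =>
    induction s using induction_on with
    | tmul x a => simp [tripleRightAux, TwoBimodule.unitProd_symm_act₂]
    | add s t hs ht => simp only [add_tmul, map_add, hs, ht]
  | add s t hs ht => simp only [map_add, hs, ht]

theorem tripleRight_C (r : Rᵐᵒᵖ) (t : W.tens R (W.tens R R)) :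
    Λ.tripleRight (W.tensMap LinearMap.id (W.tensMap LinearMap.id (mulRight R r)) t) =
      ofRight Λ.bimod.act₁ Λ.bimod.act₁ r (Λ.tripleRight t) := by
  rw [tripleRight_natural]
  show _ = ofRight Λ.bimod.act₁ Λ.bimod.act₁ r (Λ.tripleRightAux
    (Λ.bimod.prodMap LinearMap.id (Λ.iso R R).symm.toLinearMap ((Λ.iso R (W.tens R R)).symm t)))
  generalize Λ.bimod.prodMap LinearMap.id (Λ.iso R R).symm.toLinearMap
    ((Λ.iso R (W.tens R R)).symm t) = s
  induction s using induction_on with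
  | tmul s b =>
    induction s using induction_on with
    | tmul x a => simp [tripleRightAux, TwoBimodule.unitProd_symm_act₁]
    | add s t hs ht => simp only [add_tmul, map_add, hs, ht]
  | add s t hs ht => simp only [map_add, hs, ht]

theorem a_A : Intertwines (ofRight Λ.bimod.act₂ Λ.bimod.act₂)
    (ofLeft Λ.bimod.act₁ Λ.bimod.act₂ Λ.bimod) Λ.a := by
  intro r t
  have h := LinearMap.congr_fun (W.assoc_natural (mulRight R r) (LinearMap.id : R →ₗ[R] R)
    (LinearMap.id : R →ₗ[R] R)) (Λ.tripleLeft t)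
  simp only [LinearMap.comp_apply] at h
  simp only [a, LinearMap.comp_apply, tripleLeft_A, h, tripleRight_A]

theorem a_B : Intertwines (ofRight Λ.bimod.act₂ Λ.bimod.act₁)
    (ofRight Λ.bimod.act₁ Λ.bimod.act₂) Λ.a := by
  intro r t
  have h := LinearMap.congr_fun (W.assoc_natural (LinearMap.id : R →ₗ[R] R) (mulRight R r)
    (LinearMap.id : R →ₗ[R] R)) (Λ.tripleLeft t)
  simp only [LinearMap.comp_apply] at h
  simp only [a, LinearMap.comp_apply, tripleLeft_B, h, tripleRight_B]

theorem a_C : Intertwines (ofLeft Λ.bimod.act₂ Λ.bimod.act₁ Λ.bimod)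
    (ofRight Λ.bimod.act₁ Λ.bimod.act₁) Λ.a := by
  intro r t
  have h := LinearMap.congr_fun (W.assoc_natural (LinearMap.id : R →ₗ[R] R)
    (LinearMap.id : R →ₗ[R] R) (mulRight R r)) (Λ.tripleLeft t)
  simp only [LinearMap.comp_apply] at h
  simp only [a, LinearMap.comp_apply, tripleLeft_C, h, tripleRight_C]

end

end AddSymMon.Rep

/-! ## Regrouping threefold products -/

namespace Tens

section

variable {R : Type u} [Ring R] {M M' : Type u} [AddCommGroup M] [Module R M]
  [AddCommGroup M'] [Module R M']

/-- The tensor product `M ⊗ A ⊗ B ⊗ C` of a module with three commuting right structures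
with three modules, the factors being tensored to `α`, `β`, `γ` respectively. -/
abbrev three (α β γ : RightAct R M) [ActComm α β] [ActComm α γ] [ActComm β γ]
    (A B C : Type u) [AddCommGroup A] [Module R A] [AddCommGroup B] [Module R B]
    [AddCommGroup C] [Module R C] : Type u :=
  Tens (ofLeft (ofLeft α β A) (ofLeft α γ A) B) C

/-- The map `f ⊗ 1 ⊗ 1 ⊗ 1`. -/
def threeMap {α β γ : RightAct R M} [ActComm α β] [ActComm α γ] [ActComm β γ]
    {α' β' γ' : RightAct R M'} [ActComm α' β'] [ActComm α' γ'] [ActComm β' γ']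
    (f : M →ₗ[R] M') (hα : Intertwines α α' f) (hβ : Intertwines β β' f)
    (hγ : Intertwines γ γ' f) (A B C : Type u) [AddCommGroup A] [Module R A] [AddCommGroup B]
    [Module R B] [AddCommGroup C] [Module R C] : three α β γ A B C →ₗ[R] three α' β' γ' A B C :=
  map (map (map f hα LinearMap.id) (map_ofLeft hα hβ LinearMap.id) LinearMap.id)
    (map_ofLeft _ (map_ofLeft hα hγ LinearMap.id) LinearMap.id) LinearMap.id

end

end Tens

namespace TwoBimodule

section

open Tens

variable {R : Type u} [Ring R] (Λ : TwoBimodule R)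

/-- The associativity
`Λ_{C,Λ} ⊗ (Λ_{B,A} ⊗ A ⊗ B) → (Λ_{C,Λ} ⊗ Λ_{B,A}) ⊗ A ⊗ B`. -/
def regroupLeftAux (A B : Type u) [AddCommGroup A] [Module R A] [AddCommGroup B] [Module R B] :
    Tens Λ.act₂ (Λ.prod A B) →ₗ[R]
      Tens (ofLeft (ofRight Λ.act₂ Λ.act₂) (ofRight Λ.act₂ Λ.act₁) A) B :=
  map (assoc Λ.act₂ Λ.act₂ A).symm.toLinearMap
      (intertwines_ext fun r x s => by
        induction s using induction_on with
        | tmul y a => rfl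
        | add s t hs ht => simp only [tmul_add, map_add, hs, ht])
      LinearMap.id ∘ₗ
    (assoc Λ.act₂ (ofLeft Λ.act₂ Λ.act₁ A) B).symm.toLinearMap

theorem regroupLeftAux_intertwines (A B : Type u) [AddCommGroup A] [Module R A]
    [AddCommGroup B] [Module R B] :
    Intertwines (ofLeft Λ.act₂ Λ.act₁ (Λ.prod A B))
      (ofLeft (ofLeft (ofRight Λ.act₂ Λ.act₂) (ofRight Λ.act₂ Λ.act₁) A)
        (ofLeft (ofRight Λ.act₂ Λ.act₂) (ofLeft Λ.act₂ Λ.act₁ Λ) A) B)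
      (Λ.regroupLeftAux A B) :=
  intertwines_ext fun r x s => by
    induction s using induction_on with
    | tmul s b =>
      induction s using induction_on with
      | tmul y a => rfl
      | add s t hs ht => simp only [tmul_add, add_tmul, map_add, hs, ht]
    | add s t hs ht => simp only [tmul_add, map_add, hs, ht]

/-- The associativity
`Λ_{C,Λ} ⊗ (Λ_{B,A} ⊗ A ⊗ B) ⊗ C → (Λ_{C,Λ} ⊗ Λ_{B,A}) ⊗ A ⊗ B ⊗ C`,
`x ⊗ (y ⊗ a ⊗ b) ⊗ c ↦ (x ⊗ y) ⊗ a ⊗ b ⊗ c`. -/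
def regroupLeft (A B C : Type u) [AddCommGroup A] [Module R A] [AddCommGroup B] [Module R B]
    [AddCommGroup C] [Module R C] :
    Λ.prod (Λ.prod A B) C →ₗ[R]
      three (ofRight Λ.act₂ Λ.act₂) (ofRight Λ.act₂ Λ.act₁) (ofLeft Λ.act₂ Λ.act₁ Λ) A B C :=
  map (Λ.regroupLeftAux A B) (Λ.regroupLeftAux_intertwines A B) LinearMap.id

/-- The permutation `(Λ_{Λ,A} ⊗ Λ_{C,B}) ⊗ A ⊗ B → (Λ_{Λ,A} ⊗ A) ⊗ (Λ_{C,B} ⊗ B)`. -/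
def regroupRightAux (A B : Type u) [AddCommGroup A] [Module R A] [AddCommGroup B] [Module R B] :
    Tens (ofLeft (ofLeft Λ.act₁ Λ.act₂ Λ) (ofRight Λ.act₁ Λ.act₂) A) B →ₗ[R]
      Tens (ofLeft Λ.act₂ Λ.act₁ A) (Tens Λ.act₂ B) :=
  (assoc (ofLeft Λ.act₂ Λ.act₁ A) Λ.act₂ B).toLinearMap ∘ₗ
    map (swap Λ.act₁ Λ.act₂ Λ A).toLinearMap
      (intertwines_ext fun r s a => by
        induction s using induction_on with
        | tmul x y => rfl
        | add s t hs ht => simp only [add_tmul, map_add, hs, ht])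
      LinearMap.id

theorem regroupRightAux_intertwines (A B : Type u) [AddCommGroup A] [Module R A]
    [AddCommGroup B] [Module R B] :
    Intertwines (ofLeft (ofLeft (ofLeft Λ.act₁ Λ.act₂ Λ) (ofRight Λ.act₁ Λ.act₂) A)
        (ofLeft (ofLeft Λ.act₁ Λ.act₂ Λ) (ofRight Λ.act₁ Λ.act₁) A) B)
      (ofRight (ofLeft Λ.act₂ Λ.act₁ A) (ofLeft Λ.act₂ Λ.act₁ B))
      (Λ.regroupRightAux A B) :=
  intertwines_ext fun r s b => by
    induction s using induction_on with
    | tmul s a =>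
      induction s using induction_on with
      | tmul x y => rfl
      | add s t hs ht => simp only [add_tmul, map_add, hs, ht]
    | add s t hs ht => simp only [add_tmul, map_add, hs, ht]

/-- The permutation
`(Λ_{Λ,A} ⊗ Λ_{C,B}) ⊗ A ⊗ B ⊗ C → Λ_{Λ,A} ⊗ A ⊗ (Λ_{C,B} ⊗ B ⊗ C)`,
`(x ⊗ y) ⊗ a ⊗ b ⊗ c ↦ x ⊗ a ⊗ (y ⊗ b ⊗ c)`. -/
def regroupRight (A B C : Type u) [AddCommGroup A] [Module R A] [AddCommGroup B] [Module R B]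
    [AddCommGroup C] [Module R C] :
    three (ofLeft Λ.act₁ Λ.act₂ Λ) (ofRight Λ.act₁ Λ.act₂) (ofRight Λ.act₁ Λ.act₁) A B C →ₗ[R]
      Λ.prod A (Λ.prod B C) :=
  (assoc (ofLeft Λ.act₂ Λ.act₁ A) (ofLeft Λ.act₂ Λ.act₁ B) C).toLinearMap ∘ₗ
    map (Λ.regroupRightAux A B) (Λ.regroupRightAux_intertwines A B) LinearMap.id

theorem regroupLeft_tmul {A B C : Type u} [AddCommGroup A] [Module R A] [AddCommGroup B]
    [Module R B] [AddCommGroup C] [Module R C] (x y : Λ) (a : A) (b : B) (c : C) :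
    Λ.regroupLeft A B C (Λ.tmul₂ x (Λ.tmul₂ y a b) c) =
      tmul _ (tmul _ (tmul _ (tmul Λ.act₂ x y) a) b) c := rfl

theorem regroupRight_tmul {A B C : Type u} [AddCommGroup A] [Module R A] [AddCommGroup B]
    [Module R B] [AddCommGroup C] [Module R C] (x y : Λ) (a : A) (b : B) (c : C) :
    Λ.regroupRight A B C (tmul _ (tmul _ (tmul _ (tmul Λ.act₁ x y) a) b) c) =
      Λ.tmul₂ x a (Λ.tmul₂ y b c) := rfl

end

end TwoBimodule

namespace AddSymMon.Rep

section

open Tens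

variable {R : Type u} [Ring R] {W : AddSymMon R} (Λ : W.Rep)

/-- The map `c ⊗ T : Λ_{B,A} ⊗ A ⊗ B → Λ_{A,B} ⊗ B ⊗ A`, `x ⊗ a ⊗ b ↦ c x ⊗ b ⊗ a`. -/
def cT (A B : Type u) [AddCommGroup A] [Module R A] [AddCommGroup B] [Module R B] :
    Λ.bimod.prod A B →ₗ[R] Λ.bimod.prod B A :=
  map (map Λ.c Λ.c_act₁ LinearMap.id) (map_ofLeft Λ.c_act₁ Λ.c_act₂ LinearMap.id)
      LinearMap.id ∘ₗ
    (swap Λ.bimod.act₂ Λ.bimod.act₁ A B).toLinearMap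

theorem cT_tmul {A B : Type u} [AddCommGroup A] [Module R A] [AddCommGroup B] [Module R B]
    (x : Λ.bimod) (a : A) (b : B) :
    Λ.cT A B (Λ.bimod.tmul₂ x a b) = Λ.bimod.tmul₂ (Λ.c x) b a := rfl

/-- The map `ℓ ⊗ 1 : Λ_{B,K} ⊗ K ⊗ B → R ⊗ B = B`. -/
def lT (B : Type u) [AddCommGroup B] [Module R B] : Λ.bimod.prod W.unit B →ₗ[R] B :=
  (lid B).toLinearMap ∘ₗ map Λ.l Λ.l_act LinearMap.id

/-- The map `a ⊗ T` from `Λ_{C,Λ} ⊗ Λ_{B,A} ⊗ A ⊗ B ⊗ C`, written as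
`Λ_{C,Λ} ⊗ (Λ_{B,A} ⊗ A ⊗ B) ⊗ C`, to `Λ_{Λ,A} ⊗ Λ_{C,B} ⊗ B ⊗ C ⊗ A`, written as
`Λ_{Λ,A} ⊗ A ⊗ (Λ_{C,B} ⊗ B ⊗ C)`. -/
def aT (A B C : Type u) [AddCommGroup A] [Module R A] [AddCommGroup B] [Module R B]
    [AddCommGroup C] [Module R C] :
    Λ.bimod.prod (Λ.bimod.prod A B) C →ₗ[R] Λ.bimod.prod A (Λ.bimod.prod B C) :=
  Λ.bimod.regroupRight A B C ∘ₗ threeMap Λ.a Λ.a_A Λ.a_B Λ.a_C A B C ∘ₗ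
    Λ.bimod.regroupLeft A B C

end

end AddSymMon.Rep

/-! ## The functors `X ⊗ -` and the data of the classification -/

section

variable {R : Type u} [Ring R]

/-- The functor `X ⊗ -` from the category of left `R`-modules to itself. -/
def Bimodule.tensorFunctor (X : Bimodule R) : ModuleCat.{u} R ⥤ ModuleCat.{u} R where
  obj M := ModuleCat.of R (Tens X.act M)
  map f := ModuleCat.ofHom (Tens.map LinearMap.id (Intertwines.id X.act) f.hom)
  map_id M := by
    apply ModuleCat.hom_ext
    exact Tens.hom_ext fun x m => rfl
  map_comp f g := by
    apply ModuleCat.hom_ext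
    exact Tens.hom_ext fun x m => rfl

/-- The functor `X ⊗ -` between the category of left `R`-modules with the structure `W` and the
category of left `R`-modules with the structure `V`. -/
def Bimodule.functor (X : Bimodule R) (W V : AddSymMon R) : W.Cat ⥤ V.Cat := X.tensorFunctor

/-- A map of bimodules. -/
structure Bimodule.Hom (X Y : Bimodule R) where
  toLin : X →ₗ[R] Y
  intertwines : Intertwines X.act Y.act toLin

/-- The natural transformation `f ⊗ -` of endofunctors of the category of left `R`-modules. -/
def Bimodule.Hom.tensorTrans {X Y : Bimodule R} (f : X.Hom Y) :
    X.tensorFunctor ⟶ Y.tensorFunctor where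
  app M := ModuleCat.ofHom (Tens.map f.toLin f.intertwines (LinearMap.id : M →ₗ[R] M))
  naturality M N g := by
    apply ModuleCat.hom_ext
    exact Tens.hom_ext fun x m => rfl

/-- The natural transformation `f ⊗ - : X ⊗ - ⟶ Y ⊗ -` of functors from `W.Cat` to `V.Cat`. -/
def Bimodule.Hom.natTrans {X Y : Bimodule R} (f : X.Hom Y) (W V : AddSymMon R) :
    X.functor W V ⟶ Y.functor W V := f.tensorTrans

open Tens

variable {W V : AddSymMon R}

/-- The data on a bimodule `X`, where `∧` is represented by `Λ` and has the unit `K`, and `□` is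
represented by `Γ` and has the unit `K'`: an isomorphism `η : K' → X ⊗ K` of left modules and an
isomorphism `m : Γ_{Y,X} ⊗ X ⊗ Y → X ⊗ Λ` of 2-fold bimodules (`Y` is another name for `X`), such
that the unit, commutativity and associativity diagrams commute.  The right structure of the
factor `Y` corresponds to the first right structure of `Λ`, that of the factor `X` to the second
one. -/
structure MonData (Λ : W.Rep) (Γ : V.Rep) (X : Bimodule R) where
  η : V.unit ≃ₗ[R] Tens X.act W.unit
  m : Γ.bimod.prod X X ≃ₗ[R] Tens X.act Λ.bimod
  m_act₁ : Intertwines (Γ.bimod.actSnd X X.act) (ofRight X.act Λ.bimod.act₁) m.toLinearMap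
  m_act₂ : Intertwines (Γ.bimod.actFst X.act X) (ofRight X.act Λ.bimod.act₂) m.toLinearMap
  /-- The composite
  `Γ ⊗ K' ⊗ Y → Γ ⊗ (X ⊗ K) ⊗ Y → (Γ ⊗ X ⊗ Y) ⊗ K → (X ⊗ Λ) ⊗ K = X ⊗ (Λ ⊗ K) → X ⊗ R = X`
  is `ℓ ⊗ 1`. -/
  unit :
    (rid X.act).toLinearMap ∘ₗ
      map LinearMap.id (Intertwines.id X.act) Λ.l ∘ₗ
      (Tens.assoc X.act Λ.bimod.act₂ W.unit).toLinearMap ∘ₗ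
      map m.toLinearMap m_act₂ LinearMap.id ∘ₗ
      Γ.bimod.pullFst X.act W.unit X ∘ₗ
      Γ.bimod.prodMap η.toLinearMap (LinearMap.id : X →ₗ[R] X) = Γ.lT X
  /-- `(1 ⊗ c) m = m (c ⊗ T)`. -/
  comm :
    map LinearMap.id (Intertwines.id X.act) Λ.c ∘ₗ m.toLinearMap = m.toLinearMap ∘ₗ Γ.cT X X
  /-- The composite
  `Γ ⊗ (Γ ⊗ X ⊗ Y) ⊗ Z → Γ ⊗ (X ⊗ Λ) ⊗ Z → (Γ ⊗ X ⊗ Z) ⊗ Λ → (X ⊗ Λ) ⊗ Λ → X ⊗ (Λ ⊗ Λ)`,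
  followed by `1 ⊗ a`, agrees with `a ⊗ T` followed by
  `Γ ⊗ X ⊗ (Γ ⊗ Y ⊗ Z) → Γ ⊗ X ⊗ (X ⊗ Λ) → (Γ ⊗ X ⊗ X) ⊗ Λ → (X ⊗ Λ) ⊗ Λ → X ⊗ (Λ ⊗ Λ)`. -/
  assoc :
    map LinearMap.id (Intertwines.id X.act) Λ.a ∘ₗ
      (Tens.assoc X.act Λ.bimod.act₂ Λ.bimod).toLinearMap ∘ₗ
      map m.toLinearMap m_act₂ LinearMap.id ∘ₗ
      Γ.bimod.pullFst X.act Λ.bimod X ∘ₗ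
      Γ.bimod.prodMap m.toLinearMap (LinearMap.id : X →ₗ[R] X) =
    (Tens.assoc X.act Λ.bimod.act₁ Λ.bimod).toLinearMap ∘ₗ
      map m.toLinearMap m_act₁ LinearMap.id ∘ₗ
      Γ.bimod.pullSnd X X.act Λ.bimod ∘ₗ
      Γ.bimod.prodMap (LinearMap.id : X →ₗ[R] X) m.toLinearMap ∘ₗ
      Γ.aT X X X

namespace MonData

variable {Λ : W.Rep} {Γ : V.Rep} {X Y : Bimodule R}

/-- The map `Γ ⊗ (X ⊗ M) ⊗ (X ⊗ N) → X ⊗ (Λ_{N,M} ⊗ M ⊗ N)` given by `m ⊗ 1 ⊗ 1`: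
`g ⊗ (x ⊗ a) ⊗ (y ⊗ b)` goes to the regrouping of `m (g ⊗ x ⊗ y) ⊗ a ⊗ b`. -/
def extend (D : MonData Λ Γ X) (M N : Type u) [AddCommGroup M] [Module R M]
    [AddCommGroup N] [Module R N] :
    Γ.bimod.prod (Tens X.act M) (Tens X.act N) →ₗ[R] Tens X.act (Λ.bimod.prod M N) :=
  (Tens.assoc X.act (ofLeft Λ.bimod.act₂ Λ.bimod.act₁ M) N).toLinearMap ∘ₗ
    map (Tens.assoc X.act Λ.bimod.act₂ M).toLinearMap
      (intertwines_ext fun r s a => by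
        induction s using induction_on with
        | tmul x y => rfl
        | add s t hs ht => simp only [add_tmul, map_add, hs, ht])
      LinearMap.id ∘ₗ
    map (map D.m.toLinearMap D.m_act₂ LinearMap.id)
      (map_ofLeft D.m_act₂ D.m_act₁ LinearMap.id) LinearMap.id ∘ₗ
    map (Γ.bimod.pullFst X.act M X) (Γ.bimod.pullFst_actSnd X.act M X.act) LinearMap.id ∘ₗ
    Γ.bimod.pullSnd (Tens X.act M) X.act N

/-- The structure maps of the symmetric monoidal functor `X ⊗ -` are those determined by `η`
and `m`. -/
def Induces (D : MonData Λ Γ X) (F : (X.functor W V).Braided) : Prop :=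
  V.lin (Functor.LaxMonoidal.ε (X.functor W V)) = D.η.toLinearMap ∧
  ∀ (M N : Type u) [AddCommGroup M] [Module R M] [AddCommGroup N] [Module R N],
    V.lin (Functor.LaxMonoidal.μ (X.functor W V) (W.of M) (W.of N)) ∘ₗ
        (Γ.iso (Tens X.act M) (Tens X.act N)).toLinearMap =
      map LinearMap.id (Intertwines.id X.act) (Λ.iso M N).toLinearMap ∘ₗ D.extend M N

/-- A map of bimodules which is compatible with `η` and with `m`. -/
def IsHom (D : MonData Λ Γ X) (E : MonData Λ Γ Y) (f : X.Hom Y) : Prop :=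
  map f.toLin f.intertwines LinearMap.id ∘ₗ D.η.toLinearMap = E.η.toLinearMap ∧
  map f.toLin f.intertwines LinearMap.id ∘ₗ D.m.toLinearMap =
    E.m.toLinearMap ∘ₗ Γ.bimod.prodMap f.toLin f.toLin

end MonData

/-- The natural transformation `α` between symmetric monoidal functors is monoidal. -/
def IsMonoidalTrans {F G : W.Cat ⥤ V.Cat} (hF : F.Braided) (hG : G.Braided) (α : F ⟶ G) : Prop :=
  NatTrans.IsMonoidal α

end

/-!
The proof rests on two observations.

A representation turns every statement about `∧` into one about the functors
`Λ ⊗ A ⊗ B`, on which the commutativity, unit and associativity isomorphisms of `∧` are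
`c ⊗ T`, `ℓ ⊗ 1` and `a ⊗ T` (`AddSymMon.Rep.braid_iso`, `leftUnit_iso`, `assoc_iso`).  This is
because an element `x ⊗ a ⊗ b` is the image of `x ⊗ 1 ⊗ 1` under the maps `R → A`, `R → B` that
send `1` to `a` and to `b`, so that a natural map is known once it is known at `R`.

For the same reason natural isomorphisms `(X ⊗ A) □ (X ⊗ B) → X ⊗ (A ∧ B)` are the same thing as
isomorphisms `m : Γ ⊗ X ⊗ X → X ⊗ Λ` of 2-fold bimodules (`exists_represents`,
`Represents.unique`): the map belonging to `m`, read
through the representations, sends `g ⊗ (x ⊗ a) ⊗ (y ⊗ b)` to the image of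
`m (g ⊗ x ⊗ y)` under `1 ⊗ (l ↦ l ⊗ a ⊗ b)` (`TwoBimodule.extendProd_tmul`).  On such elements each
coherence diagram of a symmetric monoidal functor becomes the image of the corresponding diagram
for `m` under an insertion map `1 ⊗ (l ↦ l ⊗ a ⊗ b)` or its analogue for three factors.  Hence the
diagrams for `m` imply those for all modules, and the converse follows with all modules equal to
`R` and `a = b = c = 1`, where the insertion maps are bijective
(`Represents.left_unitality_iff`, `comm_iff`, `assoc_iff`).  The right unit diagram follows from
the left one by commutativity.  The same computation compares the conditions on a bimodule map `f`
with the conditions for `f ⊗ -` to be monoidal (`MonData.isHom_iff_isMonoidalTrans`).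

It remains to see that an additive functor `F` with a right adjoint `G` is `F R ⊗ -`
(`Bimodule.comparison_isIso`).  Maps `F R ⊗ M → N` are families, linear in `m ∈ M`, of maps
`F R → N`, that is, of elements of `G N`; so they are the maps `M → G N`, which are the maps
`F M → N`.  The symmetric monoidal structure of `F` is then transported to `F R ⊗ -`.
-/

/-! ### Tensor products over `R` -/

namespace Tens

section

variable {R : Type u} [Ring R] {M M' N N' N'' : Type u}
  [AddCommGroup M] [Module R M] [AddCommGroup M'] [Module R M']
  [AddCommGroup N] [Module R N] [AddCommGroup N'] [Module R N']
  [AddCommGroup N''] [Module R N'']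

theorem map_bijective {ρ : RightAct R M} {ρ' : RightAct R M'} {f : M →ₗ[R] M'}
    (hf : Intertwines ρ ρ' f) {g : N →ₗ[R] N'} (hf' : Function.Bijective f)
    (hg' : Function.Bijective g) : Function.Bijective (map f hf g) := by
  let e := LinearEquiv.ofBijective f hf'
  let e' := LinearEquiv.ofBijective g hg'
  have he : Intertwines ρ ρ' e.toLinearMap := hf
  refine Function.bijective_iff_has_inverse.2
    ⟨map e.symm.toLinearMap he.symm e'.symm.toLinearMap, fun t => ?_, fun t => ?_⟩
  · induction t using induction_on with
    | tmul x n =>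
      exact congrArg₂ (tmul ρ) (e.symm_apply_apply x) (e'.symm_apply_apply n)
    | add s t hs ht => rw [map_add, map_add, hs, ht]
  · induction t using induction_on with
    | tmul x n =>
      exact congrArg₂ (tmul ρ') (e.apply_symm_apply x) (e'.apply_symm_apply n)
    | add s t hs ht => rw [map_add, map_add, hs, ht]

/-- The map `1 ⊗ g`. -/
abbrev mapRight (ρ : RightAct R M) (g : N →ₗ[R] N') : Tens ρ N →ₗ[R] Tens ρ N' :=
  map LinearMap.id (Intertwines.id ρ) g

theorem mapRight_comp_apply (ρ : RightAct R M) (g : N →ₗ[R] N') (g' : N' →ₗ[R] N'')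
    (t : Tens ρ N) : mapRight ρ (g' ∘ₗ g) t = mapRight ρ g' (mapRight ρ g t) := by
  induction t using induction_on with
  | tmul x n => rfl
  | add s t hs ht => simp only [map_add, hs, ht]

@[simp] theorem mapRight_id (ρ : RightAct R M) :
    mapRight ρ (LinearMap.id : N →ₗ[R] N) = LinearMap.id :=
  hom_ext fun _ _ => rfl

theorem mapRight_bijective (ρ : RightAct R M) {g : N →ₗ[R] N'} (hg : Function.Bijective g) :
    Function.Bijective (mapRight ρ g) :=
  map_bijective _ Function.bijective_id hg

/-- The map `x ↦ x ⊗ n`. -/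
def insertRight (ρ : RightAct R M) (n : N) : M →ₗ[R] Tens ρ N where
  toFun x := tmul ρ x n
  map_add' x y := add_tmul ρ x y n
  map_smul' r x := smul_tmul ρ r x n

@[simp] theorem insertRight_apply (ρ : RightAct R M) (n : N) (x : M) :
    insertRight ρ n x = tmul ρ x n := rfl

theorem insertRight_intertwines (ρ σ : RightAct R M) [ActComm ρ σ] (n : N) :
    Intertwines σ (ofLeft ρ σ N) (insertRight ρ n) := fun _ _ => rfl

/-- The associativity isomorphism `(M ⊗ N) ⊗ P ≅ M ⊗ (N ⊗ P)` respects a second right structure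
of `N`. -/
theorem assoc_intertwines (ρ : RightAct R M) (σ τ : RightAct R N) [ActComm σ τ] (P : Type u)
    [AddCommGroup P] [Module R P] :
    Intertwines (ofLeft (ofRight ρ σ) (ofRight ρ τ) P) (ofRight ρ (ofLeft σ τ P))
      (assoc ρ σ P).toLinearMap :=
  intertwines_ext fun r s p => by
    induction s using induction_on with
    | tmul x n => rfl
    | add s t hs ht => simp only [add_tmul, map_add, hs, ht]

end

end Tens

/-! ### The products `Λ ⊗ A ⊗ B` -/

namespace TwoBimodule

section

open Tens

variable {R : Type u} [Ring R] (Λ : TwoBimodule R)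
  {A A' B B' C : Type u} [AddCommGroup A] [Module R A] [AddCommGroup B] [Module R B]
  [AddCommGroup A'] [Module R A'] [AddCommGroup B'] [Module R B'] [AddCommGroup C] [Module R C]

theorem prod_induction {p : Λ.prod A B → Prop} (t : Λ.prod A B)
    (tmul : ∀ x a b, p (Λ.tmul₂ x a b)) (add : ∀ s t, p s → p t → p (s + t)) : p t := by
  induction t using induction_on with
  | tmul s b =>
    induction s using induction_on with
    | tmul x a => exact tmul x a b
    | add s t hs ht => rw [add_tmul]; exact add _ _ hs ht
  | add s t hs ht => exact add _ _ hs ht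

theorem tmul₂_add_left (x : Λ) (a a' : A) (b : B) :
    Λ.tmul₂ x (a + a') b = Λ.tmul₂ x a b + Λ.tmul₂ x a' b := by
  simp only [tmul₂, tmul_add, add_tmul]

theorem tmul₂_add_right (x : Λ) (a : A) (b b' : B) :
    Λ.tmul₂ x a (b + b') = Λ.tmul₂ x a b + Λ.tmul₂ x a b' := by
  simp only [tmul₂, tmul_add]

theorem prodMap_tmul₂ (f : A →ₗ[R] A') (g : B →ₗ[R] B') (x : Λ) (a : A) (b : B) :
    Λ.prodMap f g (Λ.tmul₂ x a b) = Λ.tmul₂ x (f a) (g b) := rfl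

theorem prodMap_comp_apply {A'' B'' : Type u} [AddCommGroup A''] [Module R A'']
    [AddCommGroup B''] [Module R B''] (f : A →ₗ[R] A') (g : B →ₗ[R] B') (f' : A' →ₗ[R] A'')
    (g' : B' →ₗ[R] B'') (t : Λ.prod A B) :
    Λ.prodMap f' g' (Λ.prodMap f g t) = Λ.prodMap (f' ∘ₗ f) (g' ∘ₗ g) t := by
  induction t using Λ.prod_induction with
  | tmul x a b => rfl
  | add s t hs ht => simp only [map_add, hs, ht]

theorem prodMap_bijective {f : A →ₗ[R] A'} {g : B →ₗ[R] B'} (hf : Function.Bijective f)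
    (hg : Function.Bijective g) : Function.Bijective (Λ.prodMap f g) :=
  map_bijective _ (map_bijective _ Function.bijective_id hf) hg

/-- The map `Λ → Λ_{B,A} ⊗ A ⊗ B`, `x ↦ x ⊗ a ⊗ b`. -/
def insert₂ (a : A) (b : B) : Λ →ₗ[R] Λ.prod A B :=
  insertRight (ofLeft Λ.act₂ Λ.act₁ A) b ∘ₗ insertRight Λ.act₂ a

@[simp] theorem insert₂_apply (a : A) (b : B) (x : Λ) : Λ.insert₂ a b x = Λ.tmul₂ x a b := rfl

/-- The map `Λ_{Λ,A} ⊗ Λ_{C,B} → Λ_{Λ,A} ⊗ A ⊗ (Λ_{C,B} ⊗ B ⊗ C)`,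
`x ⊗ y ↦ x ⊗ a ⊗ (y ⊗ b ⊗ c)`. -/
def insert₃ (a : A) (b : B) (c : C) : Tens Λ.act₁ Λ →ₗ[R] Λ.prod A (Λ.prod B C) :=
  map (insertRight Λ.act₂ a) (insertRight_intertwines Λ.act₂ Λ.act₁ a) (Λ.insert₂ b c)

@[simp] theorem insert₃_tmul (a : A) (b : B) (c : C) (x y : Λ) :
    Λ.insert₃ a b c (tmul Λ.act₁ x y) = Λ.tmul₂ x a (Λ.tmul₂ y b c) := rfl

theorem prodMap_insert₃ {C' : Type u} [AddCommGroup C'] [Module R C'] (f : A →ₗ[R] A')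
    (g : B →ₗ[R] B') (h : C →ₗ[R] C') (a : A) (b : B) (c : C) (t : Tens Λ.act₁ Λ) :
    Λ.prodMap f (Λ.prodMap g h) (Λ.insert₃ a b c t) = Λ.insert₃ (f a) (g b) (h c) t := by
  induction t using induction_on with
  | tmul x y => rfl
  | add s t hs ht => simp only [map_add, hs, ht]

/-- On elements `t ⊗ a ⊗ b ⊗ c` with arbitrary `t`, the permutation of factors is `insert₃`. -/
theorem regroupRight_insert (a : A) (b : B) (c : C) (t : Tens Λ.act₁ Λ) :
    Λ.regroupRight A B C (tmul _ (tmul _ (tmul _ t a) b) c) = Λ.insert₃ a b c t := by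
  induction t using induction_on with
  | tmul x y => rfl
  | add s t hs ht => simp only [add_tmul, map_add, hs, ht]

theorem insert₂_one_bijective : Function.Bijective (Λ.insert₂ (1 : R) (1 : R)) :=
  Λ.unitProd.bijective

theorem insert₃_one_bijective :
    Function.Bijective (Λ.insert₃ (1 : R) (1 : R) (1 : R)) :=
  map_bijective _ (rid Λ.act₂).symm.bijective Λ.unitProd.bijective

theorem pullFst_bijective (σ : RightAct R A) (N : Type u) [AddCommGroup N] [Module R N] :
    Function.Bijective (Λ.pullFst σ N B) :=
  (swap (ofRight Λ.act₂ σ) (ofLeft Λ.act₂ Λ.act₁ A) N B).bijective.comp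
    (map_bijective _ (assoc Λ.act₂ σ N).symm.bijective Function.bijective_id)

/-- Every element of `Λ ⊗ (A ⊗ M) ⊗ (B ⊗ N)` is a sum of elements `x ⊗ (a ⊗ m) ⊗ (b ⊗ n)`. -/
theorem prod_tens_induction {M N : Type u} [AddCommGroup M] [Module R M] [AddCommGroup N]
    [Module R N] {σ : RightAct R A} {τ : RightAct R B} {p : Λ.prod (Tens σ M) (Tens τ N) → Prop}
    (t : Λ.prod (Tens σ M) (Tens τ N))
    (tmul : ∀ x a m b n, p (Λ.tmul₂ x (tmul σ a m) (tmul τ b n)))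
    (add : ∀ s t, p s → p t → p (s + t)) : p t := by
  induction t using Λ.prod_induction with
  | add s t hs ht => exact add _ _ hs ht
  | tmul x s t =>
    induction s using induction_on with
    | add s s' hs hs' => rw [tmul₂_add_left]; exact add _ _ hs hs'
    | tmul a m =>
      induction t using induction_on with
      | add t t' ht ht' => rw [tmul₂_add_right]; exact add _ _ ht ht'
      | tmul b n => exact tmul x a m b n

end

end TwoBimodule

/-! ### The structure isomorphisms of a represented monoidal structure -/

namespace AddSymMon.Rep

section

open Tens

variable {R : Type u} [Ring R] {W : AddSymMon R} (Λ : W.Rep)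
  {A B C : Type u} [AddCommGroup A] [Module R A] [AddCommGroup B] [Module R B]
  [AddCommGroup C] [Module R C]

/-- The element `x ⊗ a ⊗ b` comes from `Λ ≅ Λ ⊗ R ⊗ R`; with naturality this reduces statements
about all modules to `R`. -/
theorem tmul₂_eq_prodMap (x : Λ.bimod) (a : A) (b : B) :
    Λ.bimod.tmul₂ x a b = Λ.bimod.prodMap (LinearMap.toSpanSingleton R A a)
      (LinearMap.toSpanSingleton R B b) (Λ.bimod.unitProd x) := by
  simp [TwoBimodule.unitProd_apply, TwoBimodule.prodMap_tmul₂]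

/-- The unit isomorphism `K ∧ B → B` is `ℓ ⊗ 1`. -/
theorem leftUnit_iso (t : Λ.bimod.prod W.unit B) :
    W.leftUnit B (Λ.iso W.unit B t) = Λ.lT B t := by
  induction t using induction_on with
  | add s t hs ht => simp only [map_add, hs, ht]
  | tmul s b =>
    have e : Λ.bimod.prodMap LinearMap.id (LinearMap.toSpanSingleton R B b)
        (tmul (ofLeft Λ.bimod.act₂ Λ.bimod.act₁ W.unit) s (1 : R)) =
        tmul (ofLeft Λ.bimod.act₂ Λ.bimod.act₁ W.unit) s b := by
      induction s using induction_on with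
      | tmul x a => simp
      | add s t hs ht => simp only [add_tmul, map_add, hs, ht]
    have h := LinearMap.congr_fun (W.leftUnit_natural (LinearMap.toSpanSingleton R B b))
      (Λ.iso W.unit R (tmul (ofLeft Λ.bimod.act₂ Λ.bimod.act₁ W.unit) s (1 : R)))
    simp only [LinearMap.comp_apply, ← Λ.natural] at h
    rw [e] at h
    exact h

/-- The commutativity isomorphism of `∧` is `c ⊗ T`. -/
theorem braid_iso (t : Λ.bimod.prod A B) :
    W.braid A B (Λ.iso A B t) = Λ.iso B A (Λ.cT A B t) := by
  induction t using TwoBimodule.prod_induction with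
  | add s t hs ht => simp only [map_add, hs, ht]
  | tmul x a b =>
    have h := LinearMap.congr_fun (W.braid_natural (LinearMap.toSpanSingleton R A a)
      (LinearMap.toSpanSingleton R B b)) (Λ.iso R R (Λ.bimod.unitProd x))
    simp only [LinearMap.comp_apply] at h
    rw [cT_tmul, tmul₂_eq_prodMap, tmul₂_eq_prodMap, Λ.natural, Λ.natural, h]
    simp [c]

/-- Since `a (x ⊗ y)` need not have the form `u ⊗ v`, the value of `a ⊗ T` is expressed by
`insert₃`. -/
theorem aT_tmul₂ (x y : Λ.bimod) (a : A) (b : B) (c : C) :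
    Λ.aT A B C (Λ.bimod.tmul₂ x (Λ.bimod.tmul₂ y a b) c) =
      Λ.bimod.insert₃ a b c (Λ.a (tmul Λ.bimod.act₂ x y)) :=
  Λ.bimod.regroupRight_insert a b c (Λ.a (tmul Λ.bimod.act₂ x y))

theorem tripleRightAux_insert₃ (t : Tens Λ.bimod.act₁ Λ.bimod) :
    Λ.tripleRightAux (Λ.bimod.insert₃ (1 : R) (1 : R) (1 : R) t) = t := by
  induction t using induction_on with
  | tmul x y =>
    exact congrArg₂ (tmul Λ.bimod.act₁) ((rid Λ.bimod.act₂).apply_symm_apply x)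
      (Λ.bimod.unitProd.symm_apply_apply y)
  | add s t hs ht => simp only [map_add, hs, ht]

theorem insert₃_tripleRightAux (t : Λ.bimod.prod R (Λ.bimod.prod R R)) :
    Λ.bimod.insert₃ (1 : R) (1 : R) (1 : R) (Λ.tripleRightAux t) = t := by
  obtain ⟨s, rfl⟩ := Λ.bimod.insert₃_one_bijective.2 t
  rw [tripleRightAux_insert₃]

/-- The associativity isomorphism of `∧` is `a ⊗ T`. -/
theorem assoc_iso (t : Λ.bimod.prod (Λ.bimod.prod A B) C) :
    W.assoc A B C (Λ.iso (W.tens A B) C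
        (Λ.bimod.prodMap (Λ.iso A B).toLinearMap LinearMap.id t)) =
      Λ.iso A (W.tens B C) (Λ.bimod.prodMap LinearMap.id (Λ.iso B C).toLinearMap
        (Λ.aT A B C t)) := by
  induction t using TwoBimodule.prod_induction with
  | add s t hs ht => simp only [map_add, hs, ht]
  | tmul x s c =>
    induction s using TwoBimodule.prod_induction with
    | add s t hs ht => simp only [TwoBimodule.tmul₂_add_left, map_add, hs, ht]
    | tmul y a b =>
      let f := LinearMap.toSpanSingleton R A a
      let g := LinearMap.toSpanSingleton R B b
      let h := LinearMap.toSpanSingleton R C c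
      have hn := LinearMap.congr_fun (W.assoc_natural f g h)
        (Λ.tripleLeft (tmul Λ.bimod.act₂ x y))
      simp only [LinearMap.comp_apply] at hn
      have h1 : W.tensMap (W.tensMap f g) h (Λ.tripleLeft (tmul Λ.bimod.act₂ x y)) =
          Λ.iso (W.tens A B) C (Λ.bimod.prodMap (Λ.iso A B).toLinearMap LinearMap.id
            (Λ.bimod.tmul₂ x (Λ.bimod.tmul₂ y a b) c)) := by
        have e : Λ.tripleLeft (tmul Λ.bimod.act₂ x y) = Λ.iso (W.tens R R) R
            (Λ.bimod.tmul₂ x (Λ.iso R R (Λ.bimod.unitProd y)) (1 : R)) := rfl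
        rw [e, ← Λ.natural, TwoBimodule.prodMap_tmul₂, TwoBimodule.prodMap_tmul₂,
          ← Λ.natural, ← tmul₂_eq_prodMap]
        simp [h]
      rw [← h1, hn, aT_tmul₂]
      -- By the definition of `a`, the associativity isomorphism at `R` is recovered from
      -- `a (x ⊗ y)`, because `insert₃ 1 1 1` is inverse to `tripleRightAux`.
      have h2 : W.assoc R R R (Λ.tripleLeft (tmul Λ.bimod.act₂ x y)) =
          Λ.iso R (W.tens R R) (Λ.bimod.prodMap LinearMap.id (Λ.iso R R).toLinearMap
            (Λ.bimod.insert₃ (1 : R) (1 : R) (1 : R) (Λ.a (tmul Λ.bimod.act₂ x y)))) := by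
        have e : Λ.a (tmul Λ.bimod.act₂ x y) = Λ.tripleRightAux (Λ.bimod.prodMap LinearMap.id
            (Λ.iso R R).symm.toLinearMap ((Λ.iso R (W.tens R R)).symm
              (W.assoc R R R (Λ.tripleLeft (tmul Λ.bimod.act₂ x y))))) := rfl
        rw [e, insert₃_tripleRightAux, TwoBimodule.prodMap_comp_apply]
        have e' : (Λ.iso R R).toLinearMap ∘ₗ (Λ.iso R R).symm.toLinearMap = LinearMap.id := by
          ext; simp
        rw [e', LinearMap.id_comp, TwoBimodule.prodMap_id, LinearMap.id_apply,
          LinearEquiv.apply_symm_apply]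
      rw [h2, ← Λ.natural, TwoBimodule.prodMap_comp_apply]
      have e : W.tensMap g h ∘ₗ (Λ.iso R R).toLinearMap =
          (Λ.iso B C).toLinearMap ∘ₗ Λ.bimod.prodMap g h :=
        LinearMap.ext fun t => (Λ.natural g h t).symm
      rw [e, LinearMap.comp_id]
      have e' := Λ.bimod.prodMap_comp_apply f (Λ.bimod.prodMap g h) LinearMap.id
        (Λ.iso B C).toLinearMap (Λ.bimod.insert₃ 1 1 1 (Λ.a (tmul Λ.bimod.act₂ x y)))
      rw [LinearMap.id_comp] at e'
      rw [← e', TwoBimodule.prodMap_insert₃]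
      simp [f, g, h]

end

end AddSymMon.Rep

/-! ### The extension `m ⊗ 1 ⊗ 1` of a map of 2-fold bimodules -/

namespace TwoBimodule

section

open Tens

variable {R : Type u} [Ring R] {Γ Λ : TwoBimodule R} {X : Bimodule R}
  (m : Γ.prod X X →ₗ[R] Tens X.act Λ)
  (h₁ : Intertwines (Γ.actSnd X X.act) (ofRight X.act Λ.act₁) m)
  (h₂ : Intertwines (Γ.actFst X.act X) (ofRight X.act Λ.act₂) m)
  {A A' B B' : Type u} [AddCommGroup A] [Module R A] [AddCommGroup B] [Module R B]
  [AddCommGroup A'] [Module R A'] [AddCommGroup B'] [Module R B']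

/-- The map `Γ ⊗ (X ⊗ A) ⊗ (X ⊗ B) → X ⊗ (Λ_{B,A} ⊗ A ⊗ B)` given by `m ⊗ 1 ⊗ 1`, for a map
`m : Γ ⊗ X ⊗ X → X ⊗ Λ` of 2-fold bimodules which need not satisfy any of the coherence
conditions.  If `m` belongs to a `MonData`, this is `MonData.extend` by definition. -/
def extendProd (A B : Type u) [AddCommGroup A] [Module R A] [AddCommGroup B] [Module R B] :
    Γ.prod (Tens X.act A) (Tens X.act B) →ₗ[R] Tens X.act (Λ.prod A B) :=
  (Tens.assoc X.act (ofLeft Λ.act₂ Λ.act₁ A) B).toLinearMap ∘ₗ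
    map (Tens.assoc X.act Λ.act₂ A).toLinearMap
      (assoc_intertwines X.act Λ.act₂ Λ.act₁ A) LinearMap.id ∘ₗ
    map (map m h₂ LinearMap.id) (map_ofLeft h₂ h₁ LinearMap.id) LinearMap.id ∘ₗ
    map (Γ.pullFst X.act A X) (Γ.pullFst_actSnd X.act A X.act) LinearMap.id ∘ₗ
    Γ.pullSnd (Tens X.act A) X.act B

theorem extendProd_tmul (g : Γ) (x y : X) (a : A) (b : B) :
    extendProd m h₁ h₂ A B (Γ.tmul₂ g (tmul X.act x a) (tmul X.act y b)) =
      mapRight X.act (Λ.insert₂ a b) (m (Γ.tmul₂ g x y)) := by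
  show Tens.assoc X.act (ofLeft Λ.act₂ Λ.act₁ A) B
    (map (Tens.assoc X.act Λ.act₂ A).toLinearMap
      (assoc_intertwines X.act Λ.act₂ Λ.act₁ A) LinearMap.id (tmul _
        (tmul _ (m (Γ.tmul₂ g x y)) a) b)) = _
  generalize m (Γ.tmul₂ g x y) = t
  induction t using induction_on with
  | tmul x l => rfl
  | add s t hs ht => simp only [add_tmul, map_add, hs, ht]

theorem extendProd_natural (f : A →ₗ[R] A') (g : B →ₗ[R] B')
    (t : Γ.prod (Tens X.act A) (Tens X.act B)) :
    extendProd m h₁ h₂ A' B' (Γ.prodMap (mapRight X.act f) (mapRight X.act g) t) =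
      mapRight X.act (Λ.prodMap f g) (extendProd m h₁ h₂ A B t) := by
  induction t using prod_tens_induction with
  | add s t hs ht => simp only [map_add, hs, ht]
  | tmul z x a y b =>
    simp only [prodMap_tmul₂, map_tmul, LinearMap.id_apply, extendProd_tmul,
      ← mapRight_comp_apply]
    rfl

theorem extendProd_bijective (hm : Function.Bijective m) :
    Function.Bijective (extendProd m h₁ h₂ A B) := by
  unfold extendProd
  simp only [LinearMap.coe_comp]
  refine .comp ?_ (.comp ?_ (.comp ?_ (.comp ?_ ?_)))
  · exact LinearEquiv.bijective _
  · exact map_bijective _ (LinearEquiv.bijective _) Function.bijective_id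
  · exact map_bijective _ (map_bijective _ hm Function.bijective_id) Function.bijective_id
  · exact map_bijective _ (Γ.pullFst_bijective X.act A) Function.bijective_id
  · exact LinearEquiv.bijective _

/-- The left hand side of the associativity condition for `m`. -/
def assocLeft (s : Γ.prod (Γ.prod X X) X) : Tens X.act (Tens Λ.act₂ Λ) :=
  Tens.assoc X.act Λ.act₂ Λ (map m h₂ LinearMap.id (Γ.pullFst X.act Λ X
    (Γ.prodMap m (LinearMap.id : X →ₗ[R] X) s)))

/-- The last three maps on the right hand side of the associativity condition for `m`. -/
def assocRight (s : Γ.prod X (Γ.prod X X)) : Tens X.act (Tens Λ.act₁ Λ) :=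
  Tens.assoc X.act Λ.act₁ Λ (map m h₁ LinearMap.id (Γ.pullSnd X X.act Λ
    (Γ.prodMap (LinearMap.id : X →ₗ[R] X) m s)))

theorem assocLeft_add (s t : Γ.prod (Γ.prod X X) X) :
    assocLeft m h₂ (s + t) = assocLeft m h₂ s + assocLeft m h₂ t := by
  simp only [assocLeft, map_add]

theorem assocRight_add (s t : Γ.prod X (Γ.prod X X)) :
    assocRight m h₁ (s + t) = assocRight m h₁ s + assocRight m h₁ t := by
  simp only [assocRight, map_add]

end

end TwoBimodule

namespace AddSymMon.Rep

section

open Tens TwoBimodule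

variable {R : Type u} [Ring R] {W V : AddSymMon R} {Λ : W.Rep} {Γ : V.Rep} {X : Bimodule R}
  (m : Γ.bimod.prod X X →ₗ[R] Tens X.act Λ.bimod)
  (h₁ : Intertwines (Γ.bimod.actSnd X X.act) (ofRight X.act Λ.bimod.act₁) m)
  (h₂ : Intertwines (Γ.bimod.actFst X.act X) (ofRight X.act Λ.bimod.act₂) m)
  {A B C : Type u} [AddCommGroup A] [Module R A] [AddCommGroup B] [Module R B]
  [AddCommGroup C] [Module R C]

/-- The left unit diagram at a module `A`, on elements whose middle factor `t ∈ X ⊗ K` is arbitrary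
(in the application it is a value of `η`), is the unit diagram for `m` tensored with `A`. -/
theorem lT_extendProd (g : Γ.bimod) (t : Tens X.act W.unit) (y : X) (a : A) :
    mapRight X.act (Λ.lT A) (extendProd m h₁ h₂ W.unit A (Γ.bimod.tmul₂ g t (tmul X.act y a))) =
      tmul X.act (rid X.act (mapRight X.act Λ.l (Tens.assoc X.act Λ.bimod.act₂ W.unit
        (map m h₂ LinearMap.id (Γ.bimod.pullFst X.act W.unit X (Γ.bimod.tmul₂ g t y)))))) a := by
  induction t using induction_on with
  | add s t hs ht => simp only [tmul₂_add_left, map_add, hs, ht, add_tmul]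
  | tmul x k =>
    rw [extendProd_tmul, pullFst_tmul, map_tmul]
    generalize m (Γ.bimod.tmul₂ g x y) = s
    induction s using induction_on with
    | add s t hs ht => simp only [map_add, hs, ht, add_tmul]
    | tmul z l =>
      simp only [map_tmul, LinearMap.id_apply, assoc_tmul, rid_tmul, act_tmul]
      rfl

/-- With `extendProd_cT`: the two composites of the commutativity diagram at `A`, `B` are the two
composites for `m`, followed by the same insertion map. -/
theorem cT_extendProd (g : Γ.bimod) (x y : X) (a : A) (b : B) :
    mapRight X.act (Λ.cT A B)
        (extendProd m h₁ h₂ A B (Γ.bimod.tmul₂ g (tmul X.act x a) (tmul X.act y b))) =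
      mapRight X.act (Λ.bimod.insert₂ b a) (mapRight X.act Λ.c (m (Γ.bimod.tmul₂ g x y))) := by
  rw [extendProd_tmul, ← mapRight_comp_apply, ← mapRight_comp_apply]
  rfl

theorem extendProd_cT (g : Γ.bimod) (x y : X) (a : A) (b : B) :
    extendProd m h₁ h₂ B A (Γ.cT (Tens X.act A) (Tens X.act B)
        (Γ.bimod.tmul₂ g (tmul X.act x a) (tmul X.act y b))) =
      mapRight X.act (Λ.bimod.insert₂ b a) (m (Γ.cT X X (Γ.bimod.tmul₂ g x y))) := by
  rw [cT_tmul, extendProd_tmul, cT_tmul]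

/-- With `extendProd_aT`: the two composites of the associativity diagram at `A`, `B`, `C` are the
two composites for `m`, followed by the same insertion map. -/
theorem aT_extendProd (g g' : Γ.bimod) (x y z : X) (a : A) (b : B) (c : C) :
    mapRight X.act (Λ.aT A B C) (extendProd m h₁ h₂ (Λ.bimod.prod A B) C
      (Γ.bimod.prodMap (extendProd m h₁ h₂ A B) LinearMap.id
        (Γ.bimod.tmul₂ g (Γ.bimod.tmul₂ g' (tmul X.act x a) (tmul X.act y b))
          (tmul X.act z c)))) =
      mapRight X.act (Λ.bimod.insert₃ a b c) (mapRight X.act Λ.a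
        (assocLeft m h₂ (Γ.bimod.tmul₂ g (Γ.bimod.tmul₂ g' x y) z))) := by
  rw [assocLeft, prodMap_tmul₂, prodMap_tmul₂, extendProd_tmul]
  generalize m (Γ.bimod.tmul₂ g' x y) = s
  induction s using induction_on with
  | add s t hs ht => simp only [tmul₂_add_left, map_add, hs, ht]
  | tmul w l =>
    rw [map_tmul, LinearMap.id_apply, LinearMap.id_apply, LinearMap.id_apply, extendProd_tmul,
      pullFst_tmul, map_tmul]
    generalize m (Γ.bimod.tmul₂ g w z) = s
    induction s using induction_on with
    | add s t hs ht => simp only [map_add, hs, ht, add_tmul]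
    | tmul w l' =>
      simp only [map_tmul, LinearMap.id_apply, assoc_tmul, insert₂_apply, aT_tmul₂]

theorem extendProd_aT (g g' : Γ.bimod) (x y z : X) (a : A) (b : B) (c : C) :
    extendProd m h₁ h₂ A (Λ.bimod.prod B C)
      (Γ.bimod.prodMap LinearMap.id (extendProd m h₁ h₂ B C)
        (Γ.aT (Tens X.act A) (Tens X.act B) (Tens X.act C)
          (Γ.bimod.tmul₂ g (Γ.bimod.tmul₂ g' (tmul X.act x a) (tmul X.act y b))
            (tmul X.act z c)))) =
      mapRight X.act (Λ.bimod.insert₃ a b c)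
        (assocRight m h₁ (Γ.aT X X X (Γ.bimod.tmul₂ g (Γ.bimod.tmul₂ g' x y) z))) := by
  rw [aT_tmul₂, aT_tmul₂]
  generalize Γ.a (tmul Γ.bimod.act₂ g g') = w
  unfold assocRight
  induction w using induction_on with
  | add s t hs ht => simp only [map_add, hs, ht]
  | tmul u v =>
    rw [insert₃_tmul, insert₃_tmul, prodMap_tmul₂, prodMap_tmul₂, extendProd_tmul]
    generalize m (Γ.bimod.tmul₂ v y z) = s
    induction s using induction_on with
    | add s t hs ht => simp only [tmul₂_add_right, map_add, hs, ht]
    | tmul x' l =>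
      rw [map_tmul, LinearMap.id_apply, LinearMap.id_apply, LinearMap.id_apply, extendProd_tmul,
        pullSnd_tmul, map_tmul]
      generalize m (Γ.bimod.tmul₂ u x x') = s
      induction s using induction_on with
      | add s t hs ht => simp only [map_add, hs, ht, add_tmul]
      | tmul w l' =>
        simp only [map_tmul, LinearMap.id_apply, assoc_tmul, insert₂_apply, insert₃_tmul]

end

end AddSymMon.Rep

/-! ### Coherence at `R` and coherence at all modules -/

namespace AddSymMon.Rep

section

open Tens TwoBimodule

variable {R : Type u} [Ring R] {W V : AddSymMon R} {Λ : W.Rep} {Γ : V.Rep} {X : Bimodule R}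
  (m : Γ.bimod.prod X X →ₗ[R] Tens X.act Λ.bimod)
  (h₁ : Intertwines (Γ.bimod.actSnd X X.act) (ofRight X.act Λ.bimod.act₁) m)
  (h₂ : Intertwines (Γ.bimod.actFst X.act X) (ofRight X.act Λ.bimod.act₂) m)

theorem unit_iff_extendProd (η : V.unit →ₗ[R] Tens X.act W.unit) :
    (∀ t, rid X.act (mapRight X.act Λ.l (Tens.assoc X.act Λ.bimod.act₂ W.unit
      (map m h₂ LinearMap.id (Γ.bimod.pullFst X.act W.unit X
        (Γ.bimod.prodMap η LinearMap.id t))))) = Γ.lT X t) ↔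
    ∀ (A : Type u) [AddCommGroup A] [Module R A] (t : Γ.bimod.prod V.unit (Tens X.act A)),
      mapRight X.act (Λ.lT A)
        (extendProd m h₁ h₂ W.unit A (Γ.bimod.prodMap η LinearMap.id t)) =
      Γ.lT (Tens X.act A) t := by
  constructor
  · intro h A _ _ t
    induction t using TwoBimodule.prod_induction with
    | add s t hs ht => simp only [map_add, hs, ht]
    | tmul g k s =>
      induction s using induction_on with
      | add s t hs ht => simp only [tmul₂_add_right, map_add, hs, ht]
      | tmul y a =>
        have e := h (Γ.bimod.tmul₂ g k y)
        rw [prodMap_tmul₂, LinearMap.id_apply] at e ⊢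
        rw [lT_extendProd, e]
        exact smul_tmul _ _ _ _
  · intro h t
    induction t using TwoBimodule.prod_induction with
    | add s t hs ht => simp only [map_add, hs, ht]
    | tmul g k y =>
      have e := h R (Γ.bimod.tmul₂ g k (tmul X.act y (1 : R)))
      rw [prodMap_tmul₂, LinearMap.id_apply] at e ⊢
      rw [lT_extendProd] at e
      exact (rid X.act).symm.injective (e.trans (smul_tmul _ _ _ _).symm)

theorem comm_iff_extendProd :
    (∀ t, mapRight X.act Λ.c (m t) = m (Γ.cT X X t)) ↔
    ∀ (A B : Type u) [AddCommGroup A] [Module R A] [AddCommGroup B] [Module R B]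
      (t : Γ.bimod.prod (Tens X.act A) (Tens X.act B)),
      mapRight X.act (Λ.cT A B) (extendProd m h₁ h₂ A B t) =
        extendProd m h₁ h₂ B A (Γ.cT _ _ t) := by
  constructor
  · intro h A B _ _ _ _ t
    induction t using prod_tens_induction with
    | add s t hs ht => simp only [map_add, hs, ht]
    | tmul g x a y b => rw [cT_extendProd, extendProd_cT, h]
  · intro h t
    induction t using TwoBimodule.prod_induction with
    | add s t hs ht => simp only [map_add, hs, ht]
    | tmul g x y =>
      have e := h R R (Γ.bimod.tmul₂ g (tmul X.act x (1 : R)) (tmul X.act y (1 : R)))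
      rw [cT_extendProd, extendProd_cT] at e
      exact (mapRight_bijective X.act Λ.bimod.insert₂_one_bijective).1 e

theorem assoc_iff_extendProd :
    (∀ s, mapRight X.act Λ.a (assocLeft m h₂ s) = assocRight m h₁ (Γ.aT X X X s)) ↔
    ∀ (A B C : Type u) [AddCommGroup A] [Module R A] [AddCommGroup B] [Module R B]
      [AddCommGroup C] [Module R C]
      (t : Γ.bimod.prod (Γ.bimod.prod (Tens X.act A) (Tens X.act B)) (Tens X.act C)),
      mapRight X.act (Λ.aT A B C) (extendProd m h₁ h₂ (Λ.bimod.prod A B) C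
        (Γ.bimod.prodMap (extendProd m h₁ h₂ A B) LinearMap.id t)) =
      extendProd m h₁ h₂ A (Λ.bimod.prod B C)
        (Γ.bimod.prodMap LinearMap.id (extendProd m h₁ h₂ B C) (Γ.aT _ _ _ t)) := by
  constructor
  · intro h A B C _ _ _ _ _ _ t
    induction t using TwoBimodule.prod_induction with
    | add s t hs ht => simp only [map_add, hs, ht]
    | tmul g s r =>
      induction r using induction_on with
      | add s t hs ht => simp only [tmul₂_add_right, map_add, hs, ht]
      | tmul z c =>
        induction s using prod_tens_induction with
        | add s t hs ht => simp only [tmul₂_add_left, map_add, hs, ht]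
        | tmul g' x a y b =>
          rw [aT_extendProd, extendProd_aT, h]
  · intro h s
    induction s using TwoBimodule.prod_induction with
    | add s t hs ht =>
      rw [assocLeft_add, map_add, map_add, assocRight_add, hs, ht]
    | tmul g s z =>
      induction s using TwoBimodule.prod_induction with
      | add s t hs ht =>
        rw [tmul₂_add_left, assocLeft_add, map_add, map_add, assocRight_add, hs, ht]
      | tmul g' x y =>
        have e := h R R R (Γ.bimod.tmul₂ g (Γ.bimod.tmul₂ g' (tmul X.act x (1 : R))
          (tmul X.act y (1 : R))) (tmul X.act z (1 : R)))
        rw [aT_extendProd, extendProd_aT] at e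
        exact (mapRight_bijective X.act Λ.bimod.insert₃_one_bijective).1 e

end

end AddSymMon.Rep

/-! ### Product maps represented by a map of 2-fold bimodules -/

namespace AddSymMon.Rep

section

open Tens TwoBimodule

variable {R : Type u} [Ring R] {W V : AddSymMon R} {Λ : W.Rep} {Γ : V.Rep} {X : Bimodule R}
  (m : Γ.bimod.prod X X →ₗ[R] Tens X.act Λ.bimod)
  (h₁ : Intertwines (Γ.bimod.actSnd X X.act) (ofRight X.act Λ.bimod.act₁) m)
  (h₂ : Intertwines (Γ.bimod.actFst X.act X) (ofRight X.act Λ.bimod.act₂) m)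
  (μ : ∀ (A B : Type u) [AddCommGroup A] [Module R A] [AddCommGroup B] [Module R B],
    V.tens (Tens X.act A) (Tens X.act B) →ₗ[R] Tens X.act (W.tens A B))

/-- The maps `(X ⊗ A) □ (X ⊗ B) → X ⊗ (A ∧ B)` correspond to `m ⊗ 1 ⊗ 1` under the
representations of `□` and `∧`. -/
def Represents : Prop :=
  ∀ (A B : Type u) [AddCommGroup A] [Module R A] [AddCommGroup B] [Module R B]
    (t : Γ.bimod.prod (Tens X.act A) (Tens X.act B)),
    μ A B (Γ.iso _ _ t) = mapRight X.act (Λ.iso A B).toLinearMap (extendProd m h₁ h₂ A B t)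

variable {m h₁ h₂ μ}

theorem Represents.natural (hμ : Represents m h₁ h₂ μ) {A A' B B' : Type u}
    [AddCommGroup A] [Module R A] [AddCommGroup B] [Module R B]
    [AddCommGroup A'] [Module R A'] [AddCommGroup B'] [Module R B']
    (f : A →ₗ[R] A') (g : B →ₗ[R] B') (t : V.tens (Tens X.act A) (Tens X.act B)) :
    μ A' B' (V.tensMap (mapRight X.act f) (mapRight X.act g) t) =
      mapRight X.act (W.tensMap f g) (μ A B t) := by
  obtain ⟨t, rfl⟩ := (Γ.iso _ _).surjective t
  rw [← Γ.natural, hμ, hμ, extendProd_natural, ← mapRight_comp_apply, ← mapRight_comp_apply]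
  congr 2
  exact LinearMap.ext fun s => Λ.natural f g s

theorem Represents.bijective (hμ : Represents m h₁ h₂ μ) (hm : Function.Bijective m)
    (A B : Type u) [AddCommGroup A] [Module R A] [AddCommGroup B] [Module R B] :
    Function.Bijective (μ A B) := by
  have e : μ A B ∘ Γ.iso _ _ =
      mapRight X.act (Λ.iso A B).toLinearMap ∘ extendProd m h₁ h₂ A B := funext (hμ A B)
  rw [← Function.Bijective.of_comp_iff _ (Γ.iso _ _).bijective, e]
  exact (mapRight_bijective X.act (Λ.iso A B).bijective).comp (extendProd_bijective m h₁ h₂ hm)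

theorem Represents.left_unitality_iff (hμ : Represents m h₁ h₂ μ)
    (η : V.unit →ₗ[R] Tens X.act W.unit) :
    (∀ t, rid X.act (mapRight X.act Λ.l (Tens.assoc X.act Λ.bimod.act₂ W.unit
      (map m h₂ LinearMap.id (Γ.bimod.pullFst X.act W.unit X
        (Γ.bimod.prodMap η LinearMap.id t))))) = Γ.lT X t) ↔
    ∀ (A : Type u) [AddCommGroup A] [Module R A] (t : V.tens V.unit (Tens X.act A)),
      V.leftUnit (Tens X.act A) t =
        mapRight X.act (W.leftUnit A) (μ W.unit A (V.tensMap η LinearMap.id t)) := by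
  rw [unit_iff_extendProd m h₁ h₂]
  refine forall_congr' fun A => forall_congr' fun _ => forall_congr' fun _ => ?_
  rw [(Γ.iso _ _).surjective.forall]
  refine forall_congr' fun t => ?_
  rw [← Γ.natural, hμ, ← mapRight_comp_apply, leftUnit_iso]
  have e : W.leftUnit A ∘ₗ (Λ.iso W.unit A).toLinearMap = Λ.lT A :=
    LinearMap.ext fun t => Λ.leftUnit_iso t
  rw [e, eq_comm]

theorem Represents.comm_iff (hμ : Represents m h₁ h₂ μ) :
    (∀ t, mapRight X.act Λ.c (m t) = m (Γ.cT X X t)) ↔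
    ∀ (A B : Type u) [AddCommGroup A] [Module R A] [AddCommGroup B] [Module R B]
      (t : V.tens (Tens X.act A) (Tens X.act B)),
      mapRight X.act (W.braid A B) (μ A B t) = μ B A (V.braid _ _ t) := by
  rw [comm_iff_extendProd m h₁ h₂]
  refine forall_congr' fun A => forall_congr' fun B => forall_congr' fun _ =>
    forall_congr' fun _ => forall_congr' fun _ => forall_congr' fun _ => ?_
  rw [(Γ.iso _ _).surjective.forall]
  refine forall_congr' fun t => ?_
  rw [hμ, ← mapRight_comp_apply, braid_iso, hμ]
  have e : W.braid A B ∘ₗ (Λ.iso A B).toLinearMap = (Λ.iso B A).toLinearMap ∘ₗ Λ.cT A B :=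
    LinearMap.ext fun t => Λ.braid_iso t
  rw [e, mapRight_comp_apply,
    (mapRight_bijective X.act (Λ.iso B A).bijective).1.eq_iff]

theorem Represents.assoc_iff (hμ : Represents m h₁ h₂ μ) :
    (∀ s, mapRight X.act Λ.a (assocLeft m h₂ s) = assocRight m h₁ (Γ.aT X X X s)) ↔
    ∀ (A B C : Type u) [AddCommGroup A] [Module R A] [AddCommGroup B] [Module R B]
      [AddCommGroup C] [Module R C]
      (t : V.tens (V.tens (Tens X.act A) (Tens X.act B)) (Tens X.act C)),
      mapRight X.act (W.assoc A B C) (μ (W.tens A B) C (V.tensMap (μ A B) LinearMap.id t)) =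
        μ A (W.tens B C) (V.tensMap LinearMap.id (μ B C) (V.assoc _ _ _ t)) := by
  rw [assoc_iff_extendProd m h₁ h₂]
  refine forall_congr' fun A => forall_congr' fun B => forall_congr' fun C =>
    forall_congr' fun _ => forall_congr' fun _ => forall_congr' fun _ =>
    forall_congr' fun _ => forall_congr' fun _ => forall_congr' fun _ => ?_
  -- Every element of the source comes from some `t` through the representation of `□`, used twice.
  have hs : Function.Surjective (fun t => Γ.iso (V.tens (Tens X.act A) (Tens X.act B))
      (Tens X.act C) (Γ.bimod.prodMap (Γ.iso _ _).toLinearMap LinearMap.id t)) :=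
    (Γ.iso _ _).surjective.comp
      (Γ.bimod.prodMap_bijective (Γ.iso _ _).bijective Function.bijective_id).2
  rw [hs.forall]
  refine forall_congr' fun t => ?_
  have hl : μ (W.tens A B) C (V.tensMap (μ A B) LinearMap.id
      (Γ.iso _ _ (Γ.bimod.prodMap (Γ.iso _ _).toLinearMap LinearMap.id t))) =
      mapRight X.act ((Λ.iso (W.tens A B) C).toLinearMap ∘ₗ
          Λ.bimod.prodMap (Λ.iso A B).toLinearMap LinearMap.id)
        (extendProd m h₁ h₂ (Λ.bimod.prod A B) C
          (Γ.bimod.prodMap (extendProd m h₁ h₂ A B) LinearMap.id t)) := by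
    have e : μ A B ∘ₗ (Γ.iso _ _).toLinearMap =
        mapRight X.act (Λ.iso A B).toLinearMap ∘ₗ extendProd m h₁ h₂ A B :=
      LinearMap.ext (hμ A B)
    rw [mapRight_comp_apply, ← extendProd_natural, mapRight_id, ← Γ.natural, hμ,
      prodMap_comp_apply, prodMap_comp_apply, e]
  have hr : μ A (W.tens B C) (V.tensMap LinearMap.id (μ B C)
      (Γ.iso _ _ (Γ.bimod.prodMap LinearMap.id (Γ.iso _ _).toLinearMap (Γ.aT _ _ _ t)))) =
      mapRight X.act ((Λ.iso A (W.tens B C)).toLinearMap ∘ₗ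
          Λ.bimod.prodMap LinearMap.id (Λ.iso B C).toLinearMap)
        (extendProd m h₁ h₂ A (Λ.bimod.prod B C)
          (Γ.bimod.prodMap LinearMap.id (extendProd m h₁ h₂ B C) (Γ.aT _ _ _ t))) := by
    have e : μ B C ∘ₗ (Γ.iso _ _).toLinearMap =
        mapRight X.act (Λ.iso B C).toLinearMap ∘ₗ extendProd m h₁ h₂ B C :=
      LinearMap.ext (hμ B C)
    rw [mapRight_comp_apply, ← extendProd_natural, mapRight_id, ← Γ.natural, hμ,
      prodMap_comp_apply, prodMap_comp_apply, e]
  have e : W.assoc A B C ∘ₗ (Λ.iso (W.tens A B) C).toLinearMap ∘ₗ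
      Λ.bimod.prodMap (Λ.iso A B).toLinearMap LinearMap.id =
      ((Λ.iso A (W.tens B C)).toLinearMap ∘ₗ
        Λ.bimod.prodMap LinearMap.id (Λ.iso B C).toLinearMap) ∘ₗ Λ.aT A B C :=
    LinearMap.ext fun t => Λ.assoc_iso t
  have hi : Function.Injective (mapRight X.act ((Λ.iso A (W.tens B C)).toLinearMap ∘ₗ
      Λ.bimod.prodMap LinearMap.id (Λ.iso B C).toLinearMap)) :=
    (mapRight_bijective X.act (by
      rw [LinearMap.coe_comp]
      exact (Λ.iso A (W.tens B C)).bijective.comp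
        (Λ.bimod.prodMap_bijective Function.bijective_id (Λ.iso B C).bijective))).1
  rw [hl, assoc_iso, hr, ← mapRight_comp_apply, e, mapRight_comp_apply, hi.eq_iff]

theorem Represents.unique {m' : Γ.bimod.prod X X →ₗ[R] Tens X.act Λ.bimod}
    {h₁' : Intertwines (Γ.bimod.actSnd X X.act) (ofRight X.act Λ.bimod.act₁) m'}
    {h₂' : Intertwines (Γ.bimod.actFst X.act X) (ofRight X.act Λ.bimod.act₂) m'}
    (hμ : Represents m h₁ h₂ μ) (hμ' : Represents m' h₁' h₂' μ) : m = m' := by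
  refine LinearMap.ext fun t => ?_
  induction t using TwoBimodule.prod_induction with
  | add s t hs ht => rw [map_add, map_add, hs, ht]
  | tmul g x y =>
    have e := (hμ R R (Γ.bimod.tmul₂ g (tmul X.act x (1 : R)) (tmul X.act y (1 : R)))).symm.trans
      (hμ' R R _)
    have e' := (mapRight_bijective X.act (Λ.iso R R).bijective).1 e
    rw [extendProd_tmul, extendProd_tmul] at e'
    exact (mapRight_bijective X.act Λ.bimod.insert₂_one_bijective).1 e'

/-- Natural maps `(X ⊗ A) □ (X ⊗ B) → X ⊗ (A ∧ B)` are determined by their component at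
`A = B = R`, and this component amounts to a map `m : Γ ⊗ X ⊗ X → X ⊗ Λ`; naturality with respect
to right multiplications on `R` makes `m` a map of 2-fold bimodules. -/
theorem exists_represents
    (hn : ∀ {A A' B B' : Type u} [AddCommGroup A] [Module R A] [AddCommGroup B]
      [Module R B] [AddCommGroup A'] [Module R A'] [AddCommGroup B'] [Module R B']
      (f : A →ₗ[R] A') (g : B →ₗ[R] B') (t : V.tens (Tens X.act A) (Tens X.act B)),
      μ A' B' (V.tensMap (mapRight X.act f) (mapRight X.act g) t) =
        mapRight X.act (W.tensMap f g) (μ A B t))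
    (hb : Function.Bijective (μ R R)) :
    ∃ (m : Γ.bimod.prod X X ≃ₗ[R] Tens X.act Λ.bimod)
      (h₁ : Intertwines (Γ.bimod.actSnd X X.act) (ofRight X.act Λ.bimod.act₁) m.toLinearMap)
      (h₂ : Intertwines (Γ.bimod.actFst X.act X) (ofRight X.act Λ.bimod.act₂) m.toLinearMap),
      Represents m.toLinearMap h₁ h₂ μ := by
  let p : Γ.bimod.prod X X →ₗ[R] Γ.bimod.prod (Tens X.act R) (Tens X.act R) :=
    Γ.bimod.prodMap (rid X.act).symm.toLinearMap (rid X.act).symm.toLinearMap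
  have hp : Function.Bijective p :=
    Γ.bimod.prodMap_bijective (rid X.act).symm.bijective (rid X.act).symm.bijective
  have hq : Function.Bijective (mapRight X.act (Λ.bimod.insert₂ (1 : R) (1 : R))) :=
    mapRight_bijective X.act Λ.bimod.insert₂_one_bijective
  have hi : Function.Bijective (mapRight X.act (Λ.iso R R).toLinearMap) :=
    mapRight_bijective X.act (Λ.iso R R).bijective
  let m : Γ.bimod.prod X X ≃ₗ[R] Tens X.act Λ.bimod :=
    (LinearEquiv.ofBijective p hp).trans ((Γ.iso _ _).trans ((LinearEquiv.ofBijective _ hb).trans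
      ((LinearEquiv.ofBijective _ hi).symm.trans (LinearEquiv.ofBijective _ hq).symm)))
  have hm : ∀ t, mapRight X.act (Λ.iso R R).toLinearMap
      (mapRight X.act (Λ.bimod.insert₂ (1 : R) (1 : R)) (m t)) = μ R R (Γ.iso _ _ (p t)) := by
    intro t
    have e : mapRight X.act (Λ.bimod.insert₂ (1 : R) (1 : R)) (m t) =
        (LinearEquiv.ofBijective _ hi).symm (μ R R (Γ.iso _ _ (p t))) :=
      (LinearEquiv.ofBijective _ hq).apply_symm_apply _
    rw [e]
    exact (LinearEquiv.ofBijective _ hi).apply_symm_apply _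
  -- Naturality along `f` and `g` gives all components in terms of `m`.
  have key : ∀ {A B : Type u} [AddCommGroup A] [Module R A] [AddCommGroup B] [Module R B]
      (f : R →ₗ[R] A) (g : R →ₗ[R] B) (t : Γ.bimod.prod X X),
      μ A B (Γ.iso _ _ (Γ.bimod.prodMap (mapRight X.act f) (mapRight X.act g) (p t))) =
        mapRight X.act (Λ.iso A B).toLinearMap
          (mapRight X.act (Λ.bimod.insert₂ (f 1) (g 1)) (m t)) := by
    intro A B _ _ _ _ f g t
    rw [Γ.natural, hn, ← hm, ← mapRight_comp_apply, ← mapRight_comp_apply,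
      ← mapRight_comp_apply]
    congr 2
    exact LinearMap.ext fun x => (Λ.natural f g (Λ.bimod.tmul₂ x 1 1)).symm
  have hinj : ∀ s t, mapRight X.act (Λ.iso R R).toLinearMap
      (mapRight X.act (Λ.bimod.insert₂ (1 : R) (1 : R)) s) =
      mapRight X.act (Λ.iso R R).toLinearMap
      (mapRight X.act (Λ.bimod.insert₂ (1 : R) (1 : R)) t) → s = t :=
    fun s t h => hq.1 (hi.1 h)
  have hrid : ∀ (r : Rᵐᵒᵖ) (x : X), tmul X.act (X.act r x) (1 : R) =
      tmul X.act x (mulRight R r 1) := fun r x => by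
    rw [← MulOpposite.op_unop r, act_tmul]; simp
  refine ⟨m, fun r t => hinj _ _ ?_, fun r t => hinj _ _ ?_, fun A B _ _ _ _ t => ?_⟩
  · have e : p (Γ.bimod.actSnd X X.act r t) =
        Γ.bimod.prodMap (mapRight X.act LinearMap.id) (mapRight X.act (mulRight R r)) (p t) := by
      induction t using TwoBimodule.prod_induction with
      | add s t hs ht => simp only [map_add, hs, ht]
      | tmul g x y => exact congrArg (Γ.bimod.tmul₂ g (tmul X.act x (1 : R))) (hrid r y)
    refine (hm _).trans ?_
    rw [e, key]
    refine congrArg _ ?_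
    refine Eq.trans ?_ (mapRight_comp_apply X.act (Λ.bimod.act₁ r) (Λ.bimod.insert₂ 1 1) (m t))
    congr 2
    exact LinearMap.ext fun x => (Λ.bimod.unitProd_act₁ r x).symm
  · have e : p (Γ.bimod.actFst X.act X r t) =
        Γ.bimod.prodMap (mapRight X.act (mulRight R r)) (mapRight X.act LinearMap.id) (p t) := by
      induction t using TwoBimodule.prod_induction with
      | add s t hs ht => simp only [map_add, hs, ht]
      | tmul g x y =>
        exact congrArg (fun z => Γ.bimod.tmul₂ g z (tmul X.act y (1 : R))) (hrid r x)
    refine (hm _).trans ?_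
    rw [e, key]
    refine congrArg _ ?_
    refine Eq.trans ?_ (mapRight_comp_apply X.act (Λ.bimod.act₂ r) (Λ.bimod.insert₂ 1 1) (m t))
    congr 2
    exact LinearMap.ext fun x => (Λ.bimod.unitProd_act₂ r x).symm
  · induction t using prod_tens_induction with
    | add s t hs ht => simp only [map_add, hs, ht]
    | tmul g x a y b =>
      have e := key (LinearMap.toSpanSingleton R A a) (LinearMap.toSpanSingleton R B b)
        (Γ.bimod.tmul₂ g x y)
      rw [LinearMap.toSpanSingleton_apply_one, LinearMap.toSpanSingleton_apply_one] at e
      refine Eq.trans ?_ (e.trans (congrArg (mapRight X.act (Λ.iso A B).toLinearMap)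
        (extendProd_tmul m.toLinearMap _ _ g x y a b)).symm)
      simp [p, prodMap_tmul₂]

end

end AddSymMon.Rep

/-! ### Symmetric monoidal structures on `X ⊗ -` -/

namespace AddSymMon

section

variable {R : Type u} [Ring R] (W : AddSymMon R)

theorem lin_injective {A B : W.Cat} {f g : A ⟶ B} (h : W.lin f = W.lin g) : f = g :=
  ModuleCat.hom_ext (R := R) h

theorem lin_whiskerRight {A B : W.Cat} (f : A ⟶ B) (C : W.Cat) :
    W.lin (f ▷ C) = W.tensMap (W.lin f) (LinearMap.id : W.mod C →ₗ[R] W.mod C) :=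
  congrArg W.lin (MonoidalCategory.tensorHom_id f C).symm

theorem lin_whiskerLeft {A B : W.Cat} (C : W.Cat) (f : A ⟶ B) :
    W.lin (C ◁ f) = W.tensMap (LinearMap.id : W.mod C →ₗ[R] W.mod C) (W.lin f) :=
  congrArg W.lin (MonoidalCategory.id_tensorHom C f).symm

/-- A bijective left linear map as an isomorphism of `W.Cat`. -/
noncomputable def isoOfBijective {A B : W.Cat} (f : W.mod A →ₗ[R] W.mod B)
    (hf : Function.Bijective f) : A ≅ B where
  hom := W.ofHom (A := W.mod A) (B := W.mod B) f
  inv := W.ofHom (A := W.mod B) (B := W.mod A) (LinearEquiv.ofBijective f hf).symm.toLinearMap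
  hom_inv_id := W.lin_injective
    (LinearMap.ext fun x => (LinearEquiv.ofBijective f hf).symm_apply_apply x)
  inv_hom_id := W.lin_injective
    (LinearMap.ext fun x => (LinearEquiv.ofBijective f hf).apply_symm_apply x)

theorem lin_bijective_of_iso {A B : W.Cat} (i : A ≅ B) : Function.Bijective (W.lin i.hom) :=
  Function.bijective_iff_has_inverse.2 ⟨W.lin i.inv,
    fun x => LinearMap.congr_fun (congrArg W.lin i.hom_inv_id) x,
    fun x => LinearMap.congr_fun (congrArg W.lin i.inv_hom_id) x⟩

end

end AddSymMon

namespace MonData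

section

open Tens TwoBimodule AddSymMon.Rep

variable {R : Type u} [Ring R] {W V : AddSymMon R} {Λ : W.Rep} {Γ : V.Rep} {X Y : Bimodule R}

theorem ext_of_eq {D E : MonData Λ Γ X} (hη : D.η.toLinearMap = E.η.toLinearMap)
    (hm : D.m.toLinearMap = E.m.toLinearMap) : D = E := by
  cases D
  cases E
  congr
  · exact LinearEquiv.toLinearMap_injective hη
  · exact LinearEquiv.toLinearMap_injective hm

/-- The product maps of a lax monoidal structure on `X ⊗ -`, as left linear maps. -/
def laxMap (F : (X.functor W V).LaxMonoidal) (A B : Type u) [AddCommGroup A] [Module R A]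
    [AddCommGroup B] [Module R B] : V.tens (Tens X.act A) (Tens X.act B) →ₗ[R]
      Tens X.act (W.tens A B) :=
  V.lin (F.μ (W.of A) (W.of B))

theorem induces_iff (D : MonData Λ Γ X) (F : (X.functor W V).Braided) :
    D.Induces F ↔ V.lin (Functor.LaxMonoidal.ε (X.functor W V)) = D.η.toLinearMap ∧
      Represents D.m.toLinearMap D.m_act₁ D.m_act₂ (laxMap F.toLaxMonoidal) :=
  and_congr_right fun _ => forall_congr' fun _ => forall_congr' fun _ => forall_congr' fun _ =>
    forall_congr' fun _ => forall_congr' fun _ => forall_congr' fun _ => LinearMap.ext_iff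

/-- A symmetric monoidal structure is induced by at most one pair `(η, m)`. -/
theorem Induces.eq_data {D E : MonData Λ Γ X} {F : (X.functor W V).Braided}
    (hD : D.Induces F) (hE : E.Induces F) : D = E :=
  ext_of_eq (hD.1.symm.trans hE.1)
    (((induces_iff _ _).1 hD).2.unique ((induces_iff _ _).1 hE).2)

/-- A pair `(η, m)` induces at most one symmetric monoidal structure: the maps in the opposite
direction are inverse to the unit and product maps. -/
theorem Induces.eq_braided {D : MonData Λ Γ X} {F G : (X.functor W V).Braided}
    (hF : D.Induces F) (hG : D.Induces G) : F = G := by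
  refine Functor.Braided.toMonoidal_injective _ (Functor.Monoidal.toLaxMonoidal_injective _ ?_)
  ext : 1
  · exact V.lin_injective (hF.1.trans hG.1.symm)
  · funext A B
    refine V.lin_injective (LinearMap.ext fun t => ?_)
    obtain ⟨t, rfl⟩ := (Γ.iso (Tens X.act (W.mod A)) (Tens X.act (W.mod B))).surjective t
    exact (((induces_iff _ _).1 hF).2 (W.mod A) (W.mod B) t).trans
      (((induces_iff _ _).1 hG).2 (W.mod A) (W.mod B) t).symm

theorem exists_induces (D : MonData Λ Γ X) : ∃ F : (X.functor W V).Braided, D.Induces F := by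
  let μ : ∀ (A B : Type u) [AddCommGroup A] [Module R A] [AddCommGroup B] [Module R B],
      V.tens (Tens X.act A) (Tens X.act B) →ₗ[R] Tens X.act (W.tens A B) := fun A B =>
    mapRight X.act (Λ.iso A B).toLinearMap ∘ₗ D.extend A B ∘ₗ (Γ.iso _ _).symm.toLinearMap
  have hμ : Represents D.m.toLinearMap D.m_act₁ D.m_act₂ μ := fun A B _ _ _ _ t =>
    congrArg (fun s => mapRight X.act (Λ.iso A B).toLinearMap (D.extend A B s))
      ((Γ.iso _ _).symm_apply_apply t)
  have hunit := (hμ.left_unitality_iff D.η.toLinearMap).1 (LinearMap.congr_fun D.unit)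
  have hcomm := hμ.comm_iff.1 (LinearMap.congr_fun D.comm)
  have hassoc := hμ.assoc_iff.1 (LinearMap.congr_fun D.assoc)
  let εIso : 𝟙_ V.Cat ≅ (X.functor W V).obj (𝟙_ W.Cat) :=
    V.isoOfBijective (A := 𝟙_ V.Cat) (B := (X.functor W V).obj (𝟙_ W.Cat)) D.η.toLinearMap
      D.η.bijective
  let μIso : ∀ A B : W.Cat, (X.functor W V).obj A ⊗ (X.functor W V).obj B ≅
      (X.functor W V).obj (A ⊗ B) := fun A B =>
    V.isoOfBijective (A := (X.functor W V).obj A ⊗ (X.functor W V).obj B)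
      (B := (X.functor W V).obj (A ⊗ B)) (μ (W.mod A) (W.mod B))
      (hμ.bijective D.m.bijective (W.mod A) (W.mod B))
  have hbraid : ∀ A B : W.Cat, (μIso A B).hom ≫ (X.functor W V).map (β_ A B).hom =
      (β_ ((X.functor W V).obj A) ((X.functor W V).obj B)).hom ≫ (μIso B A).hom := fun A B =>
    V.lin_injective (LinearMap.ext (hcomm (W.mod A) (W.mod B)))
  have hleft : ∀ A : W.Cat, (λ_ ((X.functor W V).obj A)).hom =
      εIso.hom ▷ (X.functor W V).obj A ≫ (μIso (𝟙_ W.Cat) A).hom ≫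
        (X.functor W V).map (λ_ A).hom := fun A => by
    refine V.lin_injective (LinearMap.ext fun t => ?_)
    rw [V.lin_comp, V.lin_comp, V.lin_whiskerRight]
    have e := hunit (W.mod A)
    exact e t
  let S : (X.functor W V).CoreMonoidal :=
    { εIso := εIso
      μIso := μIso
      μIso_hom_natural_left := fun {A B} f C => by
        refine V.lin_injective (LinearMap.ext fun t => ?_)
        rw [V.lin_comp, V.lin_comp, V.lin_whiskerRight]
        have e := hμ.natural (W.lin f) (LinearMap.id : W.mod C →ₗ[R] W.mod C) t
        rw [mapRight_id, ← W.lin_whiskerRight] at e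
        exact e
      μIso_hom_natural_right := fun {A B} C f => by
        refine V.lin_injective (LinearMap.ext fun t => ?_)
        rw [V.lin_comp, V.lin_comp, V.lin_whiskerLeft]
        have e := hμ.natural (LinearMap.id : W.mod C →ₗ[R] W.mod C) (W.lin f) t
        rw [mapRight_id, ← W.lin_whiskerLeft] at e
        exact e
      associativity := fun A B C => by
        refine V.lin_injective (LinearMap.ext fun t => ?_)
        simp only [V.lin_comp]
        rw [V.lin_whiskerRight, V.lin_whiskerLeft]
        have e := hassoc (W.mod A) (W.mod B) (W.mod C)
        exact e t
      left_unitality := hleft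
      right_unitality := fun A => by
        rw [← braiding_leftUnitor, ← braiding_leftUnitor, Functor.map_comp, reassoc_of% hbraid,
          BraidedCategory.braiding_naturality_right_assoc, hleft] }
  exact ⟨{ toMonoidal := S.toMonoidal, braided := hbraid },
    (induces_iff _ _).2 ⟨rfl, fun A B _ _ _ _ t => hμ A B t⟩⟩

theorem exists_data (Λ : W.Rep) (Γ : V.Rep) (F : (X.functor W V).Braided) :
    ∃ D : MonData Λ Γ X, D.Induces F := by
  let μ : ∀ (A B : Type u) [AddCommGroup A] [Module R A] [AddCommGroup B] [Module R B],
      V.tens (Tens X.act A) (Tens X.act B) →ₗ[R] Tens X.act (W.tens A B) :=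
    fun A B _ _ _ _ => laxMap F.toLaxMonoidal A B
  have hb : Function.Bijective (μ R R) :=
    V.lin_bijective_of_iso (Functor.Monoidal.μIso (X.functor W V) (W.of R) (W.of R))
  obtain ⟨m, h₁, h₂, hμ⟩ := exists_represents (Λ := Λ) (Γ := Γ) (μ := μ)
    (fun f g t => LinearMap.congr_fun (congrArg V.lin
      (Functor.LaxMonoidal.μ_natural (X.functor W V) (W.ofHom f) (W.ofHom g))) t) hb
  let η : V.unit ≃ₗ[R] Tens X.act W.unit :=
    LinearEquiv.ofBijective (V.lin (Functor.LaxMonoidal.ε (X.functor W V)))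
      (V.lin_bijective_of_iso (Functor.Monoidal.εIso (X.functor W V)))
  refine ⟨⟨η, m, h₁, h₂, LinearMap.ext ((hμ.left_unitality_iff η.toLinearMap).2 fun A _ _ t => ?_),
    LinearMap.ext (hμ.comm_iff.2 fun A B _ _ _ _ t => ?_),
    LinearMap.ext (hμ.assoc_iff.2 fun A B C _ _ _ _ _ _ t => ?_)⟩,
    (induces_iff _ _).2 ⟨rfl, fun A B _ _ _ _ t => hμ A B t⟩⟩
  · have e := congrArg V.lin (Functor.LaxMonoidal.left_unitality (X.functor W V) (W.of A))
    rw [V.lin_comp, V.lin_comp, V.lin_whiskerRight] at e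
    exact LinearMap.congr_fun e t
  · exact LinearMap.congr_fun (congrArg V.lin (F.braided (W.of A) (W.of B))) t
  · have e := congrArg V.lin
      (Functor.LaxMonoidal.associativity (X.functor W V) (W.of A) (W.of B) (W.of C))
    simp only [V.lin_comp] at e
    rw [V.lin_whiskerRight, V.lin_whiskerLeft] at e
    exact LinearMap.congr_fun e t

end

end MonData

/-! ### Natural transformations `X ⊗ - ⟶ Y ⊗ -` -/

namespace Tens

section

variable {R : Type u} [Ring R] {M N : Type u} [AddCommGroup M] [Module R M]
  [AddCommGroup N] [Module R N]

theorem rid_mapRight_mulRight (ρ : RightAct R M) (r : Rᵐᵒᵖ) (t : Tens ρ R) :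
    rid ρ (mapRight ρ (mulRight R r) t) = ρ r (rid ρ t) := by
  induction t using induction_on with
  | add s t hs ht => simp only [map_add, hs, ht]
  | tmul x s =>
    rw [map_tmul, rid_tmul, rid_tmul, mulRight_apply, MulOpposite.op_mul, map_mul]
    rfl

theorem mapRight_rid_symm (ρ : RightAct R M) (x : M) (n : N) :
    mapRight ρ (LinearMap.toSpanSingleton R N n) ((rid ρ).symm x) = tmul ρ x n := by
  simp

end

end Tens

namespace Bimodule

section

open Tens

variable {R : Type u} [Ring R] {X Y : Bimodule R}

theorem Hom.ext_of_toLin {f g : X.Hom Y} (h : f.toLin = g.toLin) : f = g := by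
  cases f
  cases g
  cases h
  rfl

theorem Hom.tensorTrans_injective {f g : X.Hom Y} (h : f.tensorTrans = g.tensorTrans) : f = g := by
  refine Hom.ext_of_toLin (LinearMap.ext fun x => ?_)
  have e := congrArg (fun α : X.tensorFunctor ⟶ Y.tensorFunctor =>
    (α.app (ModuleCat.of R R)).hom (tmul X.act x (1 : R))) h
  exact (rid Y.act).symm.injective e

/-- A natural transformation `X ⊗ - ⟶ Y ⊗ -` is determined by its component at `R`, which is a
map of bimodules because it is natural with respect to right multiplications. -/
theorem exists_hom (α : X.tensorFunctor ⟶ Y.tensorFunctor) :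
    ∃ f : X.Hom Y, f.tensorTrans = α := by
  have hn : ∀ {M : Type u} [AddCommGroup M] [Module R M] (g : R →ₗ[R] M) (t : Tens X.act R),
      (α.app (ModuleCat.of R M)).hom (mapRight X.act g t) =
        mapRight Y.act g ((α.app (ModuleCat.of R R)).hom t) := fun g t =>
    LinearMap.congr_fun (congrArg ModuleCat.Hom.hom (α.naturality (ModuleCat.ofHom g))) t
  let f : X →ₗ[R] Y := (rid Y.act).toLinearMap ∘ₗ (α.app (ModuleCat.of R R)).hom ∘ₗ
    (rid X.act).symm.toLinearMap
  have hf : ∀ x, (rid Y.act).symm (f x) =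
      (α.app (ModuleCat.of R R)).hom ((rid X.act).symm x) := fun x =>
    (rid Y.act).symm_apply_apply _
  refine ⟨⟨f, fun r x => ?_⟩, ?_⟩
  · have e : (rid X.act).symm (X.act r x) =
        mapRight X.act (mulRight R r) ((rid X.act).symm x) := by
      rw [LinearEquiv.symm_apply_eq, rid_mapRight_mulRight, LinearEquiv.apply_symm_apply]
    apply (rid Y.act).symm.injective
    rw [hf, e, hn, ← hf, LinearEquiv.eq_symm_apply, rid_mapRight_mulRight,
      LinearEquiv.apply_symm_apply]
  · ext M : 2
    refine ModuleCat.hom_ext (hom_ext fun x m => ?_)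
    have e := hn (LinearMap.toSpanSingleton R M m) ((rid X.act).symm x)
    rw [← hf, mapRight_rid_symm, mapRight_rid_symm] at e
    exact e.symm

end

end Bimodule

namespace MonData

section

open Tens TwoBimodule AddSymMon.Rep

variable {R : Type u} [Ring R] {W V : AddSymMon R} {Λ : W.Rep} {Γ : V.Rep} {X Y : Bimodule R}

theorem map_mapRight {A B : Type u} [AddCommGroup A] [Module R A] [AddCommGroup B] [Module R B]
    (f : X.Hom Y) (g : A →ₗ[R] B) (t : Tens X.act A) :
    map f.toLin f.intertwines LinearMap.id (mapRight X.act g t) =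
      mapRight Y.act g (map f.toLin f.intertwines LinearMap.id t) := by
  induction t using induction_on with
  | tmul x a => rfl
  | add s t hs ht => simp only [map_add, hs, ht]

/-- Compatibility of `f` with `m` amounts to compatibility of `f ⊗ -` with the product maps at all
modules. -/
theorem map_m_iff_map_extend (D : MonData Λ Γ X) (E : MonData Λ Γ Y) (f : X.Hom Y) :
    (∀ t, map f.toLin f.intertwines LinearMap.id (D.m t) =
      E.m (Γ.bimod.prodMap f.toLin f.toLin t)) ↔
    ∀ (A B : Type u) [AddCommGroup A] [Module R A] [AddCommGroup B] [Module R B]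
      (t : Γ.bimod.prod (Tens X.act A) (Tens X.act B)),
      map f.toLin f.intertwines LinearMap.id
          (extendProd D.m.toLinearMap D.m_act₁ D.m_act₂ A B t) =
        extendProd E.m.toLinearMap E.m_act₁ E.m_act₂ A B
          (Γ.bimod.prodMap (map f.toLin f.intertwines LinearMap.id)
            (map f.toLin f.intertwines LinearMap.id) t) := by
  constructor
  · intro h A B _ _ _ _ t
    induction t using prod_tens_induction with
    | add s t hs ht => simp only [map_add, hs, ht]
    | tmul g x a y b =>
      have e := h (Γ.bimod.tmul₂ g x y)
      rw [prodMap_tmul₂] at e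
      rw [extendProd_tmul, map_mapRight, prodMap_tmul₂, map_tmul, map_tmul, LinearMap.id_apply,
        LinearMap.id_apply, extendProd_tmul]
      exact congrArg _ e
  · intro h t
    induction t using TwoBimodule.prod_induction with
    | add s t hs ht => simp only [map_add, hs, ht]
    | tmul g x y =>
      have e := h R R (Γ.bimod.tmul₂ g (tmul X.act x (1 : R)) (tmul X.act y (1 : R)))
      rw [extendProd_tmul, map_mapRight, prodMap_tmul₂, map_tmul, map_tmul, LinearMap.id_apply,
        extendProd_tmul] at e
      exact (mapRight_bijective Y.act Λ.bimod.insert₂_one_bijective).1 e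

theorem isHom_iff_isMonoidalTrans {D : MonData Λ Γ X} {E : MonData Λ Γ Y}
    {F : (X.functor W V).Braided} {G : (Y.functor W V).Braided} (hF : D.Induces F)
    (hG : E.Induces G) (f : X.Hom Y) :
    D.IsHom E f ↔ IsMonoidalTrans F G (f.natTrans W V) := by
  have hF' := ((induces_iff _ _).1 hF).2
  have hG' := ((induces_iff _ _).1 hG).2
  have key : (∀ t, map f.toLin f.intertwines LinearMap.id (D.m t) =
      E.m (Γ.bimod.prodMap f.toLin f.toLin t)) ↔
      ∀ (A B : Type u) [AddCommGroup A] [Module R A] [AddCommGroup B] [Module R B]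
        (t : V.tens (Tens X.act A) (Tens X.act B)),
        map f.toLin f.intertwines LinearMap.id (laxMap F.toLaxMonoidal A B t) =
          laxMap G.toLaxMonoidal A B (V.tensMap (map f.toLin f.intertwines LinearMap.id)
            (map f.toLin f.intertwines LinearMap.id) t) := by
    rw [map_m_iff_map_extend]
    refine forall_congr' fun A => forall_congr' fun B => forall_congr' fun _ =>
      forall_congr' fun _ => forall_congr' fun _ => forall_congr' fun _ => ?_
    rw [(Γ.iso _ _).surjective.forall]
    refine forall_congr' fun t => ?_
    rw [← Γ.natural, hF', hG', map_mapRight,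
      (mapRight_bijective Y.act (Λ.iso A B).bijective).1.eq_iff]
  constructor
  · rintro ⟨h, h'⟩
    refine ⟨V.lin_injective ?_, fun A B => V.lin_injective (LinearMap.ext ?_)⟩
    · rw [V.lin_comp, hF.1, hG.1]
      exact h
    · have e := key.1 (LinearMap.congr_fun h') (W.mod A) (W.mod B)
      exact e
  · rintro ⟨h, h'⟩
    refine ⟨?_, LinearMap.ext (key.2 fun A B _ _ _ _ t => ?_)⟩
    · have e := congrArg V.lin h
      rw [V.lin_comp, hF.1, hG.1] at e
      exact e
    · exact LinearMap.congr_fun (congrArg V.lin (h' (W.of A) (W.of B))) t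

end

end MonData

/-! ### The right adjoint of `X ⊗ -` -/

namespace Bimodule

section

open Tens

variable {R : Type u} [Ring R]

/-- The left module `Hom_R(X, N)` of left linear maps, with `(r • f) x = f (x ⊙ r)`. -/
def HomModule (X : Bimodule R) (N : Type u) [AddCommGroup N] [Module R N] : Type u := X →ₗ[R] N

variable (X : Bimodule R)

instance (N : Type u) [AddCommGroup N] [Module R N] : AddCommGroup (X.HomModule N) :=
  inferInstanceAs (AddCommGroup (X →ₗ[R] N))

instance (N : Type u) [AddCommGroup N] [Module R N] : Module R (X.HomModule N) where
  smul r f := (show X →ₗ[R] N from f) ∘ₗ X.act (MulOpposite.op r)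
  one_smul f := LinearMap.ext fun x => by
    show (show X →ₗ[R] N from f) (X.act (MulOpposite.op 1) x) = _
    rw [MulOpposite.op_one, map_one]; rfl
  mul_smul r s f := LinearMap.ext fun x => by
    show (show X →ₗ[R] N from f) (X.act (MulOpposite.op (r * s)) x) = _
    rw [MulOpposite.op_mul, map_mul]; rfl
  smul_zero r := rfl
  smul_add r f g := rfl
  add_smul r s f := LinearMap.ext fun x => by
    show (show X →ₗ[R] N from f) (X.act (MulOpposite.op (r + s)) x) = _
    rw [MulOpposite.op_add, map_add]
    exact map_add (show X →ₗ[R] N from f) _ _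
  zero_smul f := LinearMap.ext fun x => by
    show (show X →ₗ[R] N from f) (X.act (MulOpposite.op 0) x) = _
    rw [MulOpposite.op_zero, map_zero]
    exact map_zero (show X →ₗ[R] N from f)

/-- The tensor-hom correspondence between maps `X ⊗ M → N` and maps `M → Hom_R(X, N)`. -/
def curryEquiv (M N : Type u) [AddCommGroup M] [Module R M] [AddCommGroup N] [Module R N] :
    (Tens X.act M →ₗ[R] N) ≃ (M →ₗ[R] X.HomModule N) where
  toFun f :=
    { toFun := fun m => f ∘ₗ insertRight X.act m
      map_add' := fun m m' => LinearMap.ext fun x => by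
        show f (tmul X.act x (m + m')) = f (tmul X.act x m) + f (tmul X.act x m')
        rw [tmul_add, map_add]
      map_smul' := fun r m => LinearMap.ext fun x => by
        show f (tmul X.act x (r • m)) = f (tmul X.act (X.act (MulOpposite.op r) x) m)
        rw [act_tmul] }
  invFun g := lift X.act (fun x m => (show X →ₗ[R] N from g m) x)
    (fun x y m => map_add (show X →ₗ[R] N from g m) x y)
    (fun x m m' => by rw [map_add]; rfl)
    (fun r x m => map_smul (show X →ₗ[R] N from g m) r x)
    (fun r x m => by rw [map_smul]; rfl)
  left_inv f := hom_ext fun x m => rfl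
  right_inv g := rfl

/-- The functor `X ⊗ -` is left adjoint to `Hom_R(X, -)`. -/
theorem tensorFunctor_isLeftAdjoint : X.tensorFunctor.IsLeftAdjoint :=
  (Adjunction.adjunctionOfEquivRight (F := X.tensorFunctor)
    (G_obj := fun N => ModuleCat.of R (X.HomModule N))
    (fun M N => (ModuleCat.homEquiv (M := ModuleCat.of R (Tens X.act M)) (N := N)).trans
      ((X.curryEquiv M N).trans
        (ModuleCat.homEquiv (M := M) (N := ModuleCat.of R (X.HomModule N))).symm))
    (fun _ _ _ _ _ => rfl)).isLeftAdjoint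

theorem tensorFunctor_additive : X.tensorFunctor.Additive where
  map_add {_ _ f g} := ModuleCat.hom_ext (hom_ext fun x m => tmul_add X.act x (f.hom m) (g.hom m))

end

/-! ### Additive functors with a right adjoint -/

section

open Tens

variable {R : Type u} [Ring R] (F : ModuleCat.{u} R ⥤ ModuleCat.{u} R) [F.Additive]

/-- The bimodule `F R`: right multiplications on `R` are left linear and hence act on `F R`. -/
def ofFunctor : Bimodule R where
  carrier := F.obj (ModuleCat.of R R)
  act :=
    { toFun := fun r => (F.map (ModuleCat.ofHom (mulRight R r))).hom
      map_one' := by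
        rw [map_one]
        exact congrArg ModuleCat.Hom.hom (F.map_id _)
      map_mul' := fun r s => by
        rw [map_mul]
        exact congrArg ModuleCat.Hom.hom
          (F.map_comp (ModuleCat.ofHom (mulRight R s)) (ModuleCat.ofHom (mulRight R r)))
      map_zero' := by
        rw [map_zero]
        exact congrArg ModuleCat.Hom.hom (F.map_zero (ModuleCat.of R R) (ModuleCat.of R R))
      map_add' := fun r s => by
        rw [map_add]
        exact congrArg ModuleCat.Hom.hom (F.map_add (f := ModuleCat.ofHom (mulRight R r))
          (g := ModuleCat.ofHom (mulRight R s))) }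

/-- The morphism `R ⟶ M`, `r ↦ r m`. -/
def point (M : ModuleCat.{u} R) (m : M) : ModuleCat.of R R ⟶ M :=
  ModuleCat.ofHom (LinearMap.toSpanSingleton R M m)

theorem point_add (M : ModuleCat.{u} R) (m m' : M) : point M (m + m') = point M m + point M m' :=
  ModuleCat.hom_ext (LinearMap.ext fun r => smul_add r m m')

theorem point_smul (M : ModuleCat.{u} R) (r : R) (m : M) :
    point M (r • m) = ModuleCat.ofHom (mulRight R (MulOpposite.op r)) ≫ point M m :=
  ModuleCat.hom_ext (LinearMap.ext fun s => (mul_smul s r m).symm)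

theorem point_comp {M N : ModuleCat.{u} R} (m : M) (f : M ⟶ N) :
    point M m ≫ f = point N (f.hom m) :=
  ModuleCat.hom_ext (LinearMap.ext fun r => map_smul f.hom r m)

theorem eq_point {M : ModuleCat.{u} R} (f : ModuleCat.of R R ⟶ M) : f = point M (f.hom (1 : R)) :=
  ModuleCat.hom_ext (LinearMap.ext_ring (one_smul R _).symm)

/-- The natural map `F R ⊗ M → F M`, `z ⊗ m ↦ F (r ↦ r m) z`. -/
def comparison : (ofFunctor F).tensorFunctor ⟶ F where
  app M := ModuleCat.ofHom (lift (ofFunctor F).act (fun z m => (F.map (point M m)).hom z)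
    (fun x y m => map_add _ x y)
    (fun x m m' => by rw [point_add, F.map_add]; rfl)
    (fun r x m => map_smul _ r x)
    (fun r x m => by rw [point_smul, F.map_comp]; rfl))
  naturality M N f := ModuleCat.hom_ext (hom_ext fun z m => by
    show (F.map (point N (f.hom m))).hom z = (F.map (point M m) ≫ F.map f).hom z
    rw [← F.map_comp, point_comp])

/-- If `F` has a right adjoint `G`, then a map `f : F R ⊗ M → N` extends along the comparison map:
under the adjunction the maps `f (- ⊗ m) : F R → N` correspond to maps `R → G N`, that is, to
elements of `G N`, and these elements depend linearly on `m`. -/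
theorem exists_comparison_comp_eq {G : ModuleCat.{u} R ⥤ ModuleCat.{u} R} (adj : F ⊣ G)
    {M N : ModuleCat.{u} R} (f : (ofFunctor F).tensorFunctor.obj M ⟶ N) :
    ∃ g : F.obj M ⟶ N, (comparison F).app M ≫ g = f := by
  let φ : M → (F.obj (ModuleCat.of R R) ⟶ N) := fun m =>
    ModuleCat.ofHom (f.hom ∘ₗ insertRight (ofFunctor F).act m)
  have φ_add : ∀ m m', φ (m + m') = φ m + φ m' := fun m m' =>
    ModuleCat.hom_ext (LinearMap.ext fun z =>
      (congrArg f.hom (tmul_add _ z m m')).trans (map_add f.hom _ _))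
  have φ_smul : ∀ (r : R) m, φ (r • m) =
      F.map (ModuleCat.ofHom (mulRight R (MulOpposite.op r))) ≫ φ m := fun r m =>
    ModuleCat.hom_ext (LinearMap.ext fun z =>
      congrArg f.hom (act_tmul (ofFunctor F).act r z m).symm)
  let h : M →ₗ[R] G.obj N :=
    { toFun := fun m => (adj.homEquiv _ _ (φ m)).hom (1 : R)
      map_add' := fun m m' => by
        rw [φ_add, ← adj.homAddEquiv_apply, map_add]
        rfl
      map_smul' := fun r m => by
        rw [φ_smul, adj.homEquiv_naturality_left]
        show (adj.homEquiv _ _ (φ m)).hom ((1 : R) * r) = r • (adj.homEquiv _ _ (φ m)).hom (1 : R)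
        rw [one_mul, ← map_smul, smul_eq_mul, mul_one] }
  have hφ : ∀ m, point M m ≫ ModuleCat.ofHom h = adj.homEquiv _ _ (φ m) := fun m =>
    (point_comp m (ModuleCat.ofHom h)).trans (eq_point (adj.homEquiv _ _ (φ m))).symm
  refine ⟨(adj.homEquiv M N).symm (ModuleCat.ofHom h), ModuleCat.hom_ext (hom_ext fun z m => ?_)⟩
  show (F.map (point M m) ≫ (adj.homEquiv M N).symm (ModuleCat.ofHom h)).hom z = _
  rw [← adj.homEquiv_naturality_left_symm, hφ, Equiv.symm_apply_apply]
  rfl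

/-- The extension along the comparison map is unique: it is determined by its composites with the
maps `F (r ↦ r m) : F R → F M`, since maps `M → G N` are determined by their values. -/
theorem eq_of_comparison_comp_eq {G : ModuleCat.{u} R ⥤ ModuleCat.{u} R} (adj : F ⊣ G)
    {M N : ModuleCat.{u} R} {f g : F.obj M ⟶ N}
    (h : (comparison F).app M ≫ f = (comparison F).app M ≫ g) : f = g := by
  apply (adj.homEquiv M N).injective
  have key : ∀ m, point M m ≫ adj.homEquiv M N f = point M m ≫ adj.homEquiv M N g := fun m => by
    rw [← adj.homEquiv_naturality_left, ← adj.homEquiv_naturality_left]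
    congr 1
    exact ModuleCat.hom_ext (LinearMap.ext fun z =>
      LinearMap.congr_fun (congrArg ModuleCat.Hom.hom h) (tmul (ofFunctor F).act z m))
  refine ModuleCat.hom_ext (LinearMap.ext fun m => ?_)
  have e := LinearMap.congr_fun (congrArg ModuleCat.Hom.hom (key m)) (1 : R)
  rw [point_comp, point_comp] at e
  exact (one_smul R _).symm.trans (e.trans (one_smul R _))

/-- The Eilenberg-Watts theorem: an additive functor with a right adjoint is `F R ⊗ -`. -/
theorem comparison_isIso [F.IsLeftAdjoint] : IsIso (comparison F) := by
  have adj := Adjunction.ofIsLeftAdjoint F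
  refine @NatIso.isIso_of_isIso_app _ _ _ _ _ _ _ fun M => ?_
  obtain ⟨g, hg⟩ := exists_comparison_comp_eq F adj (𝟙 ((ofFunctor F).tensorFunctor.obj M))
  refine ⟨g, hg, eq_of_comparison_comp_eq F adj ?_⟩
  rw [← Category.assoc, hg, Category.id_comp, Category.comp_id]

end

end Bimodule

/-! ### The classification -/

section

variable {R : Type u} [Ring R] {W V : AddSymMon R}

/-- A symmetric monoidal structure is transported along an isomorphism of functors. -/
theorem exists_isMonoidalTrans_of_iso {F G : W.Cat ⥤ V.Cat} (hF : F.Braided) (α : G ≅ F) :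
    ∃ hG : G.Braided, IsMonoidalTrans hG hF α.hom := by
  let S : G.Monoidal := Functor.Monoidal.transport α.symm
  have : NatTrans.IsMonoidal α.symm.hom := Functor.Monoidal.natTransIsMonoidal_of_transport α.symm
  let L : G.LaxBraided := Functor.LaxBraided.ofNatIso α.symm
  refine ⟨{ toMonoidal := S, braided := L.braided }, ?_⟩
  exact inferInstanceAs (NatTrans.IsMonoidal α.symm.inv)

theorem exists_iso_of_isLeftAdjoint (F : W.Cat ⥤ V.Cat) (hF : F.Additive) (hF' : F.IsLeftAdjoint) :
    ∃ X : Bimodule R, Nonempty (X.functor W V ≅ F) := by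
  let F' : ModuleCat.{u} R ⥤ ModuleCat.{u} R := F
  have : F'.Additive := hF
  have : F'.IsLeftAdjoint := hF'
  have := Bimodule.comparison_isIso F'
  let α : (Bimodule.ofFunctor F').tensorFunctor ≅ F' := asIso (Bimodule.comparison F')
  exact ⟨Bimodule.ofFunctor F', ⟨α⟩⟩

end

theorem theorem2p3 {R : Type u} [Ring R] {W V : AddSymMon R} (Λ : W.Rep) (Γ : V.Rep) :
    (∀ X : Bimodule R, (X.functor W V).Additive ∧ (X.functor W V).IsLeftAdjoint) ∧
    ∃ e : ∀ X : Bimodule R, MonData Λ Γ X ≃ (X.functor W V).Braided,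
      (∀ (X : Bimodule R) (D : MonData Λ Γ X), D.Induces (e X D)) ∧
      (∀ (F : W.Cat ⥤ V.Cat) (hF : F.Braided), F.Additive → F.IsLeftAdjoint →
        ∃ (X : Bimodule R) (D : MonData Λ Γ X) (α : X.functor W V ≅ F),
          IsMonoidalTrans (e X D) hF α.hom) ∧
      (∀ (X Y : Bimodule R) (D : MonData Λ Γ X) (E : MonData Λ Γ Y)
        (α : X.functor W V ⟶ Y.functor W V),
        IsMonoidalTrans (e X D) (e Y E) α ↔
          ∃! f : X.Hom Y, D.IsHom E f ∧ f.natTrans W V = α) := by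
  choose toBraided hto using fun X => MonData.exists_induces (W := W) (V := V) (Λ := Λ) (Γ := Γ)
    (X := X)
  choose toData hdata using fun X => MonData.exists_data (W := W) (V := V) (X := X) Λ Γ
  let e : ∀ X : Bimodule R, MonData Λ Γ X ≃ (X.functor W V).Braided := fun X =>
    { toFun := toBraided X
      invFun := toData X
      left_inv := fun D => (hdata X (toBraided X D)).eq_data (hto X D)
      right_inv := fun F => (hto X (toData X F)).eq_braided (hdata X F) }
  have he : ∀ (X : Bimodule R) (D : MonData Λ Γ X), D.Induces (e X D) := hto
  refine ⟨fun X => ⟨X.tensorFunctor_additive, X.tensorFunctor_isLeftAdjoint⟩, e, he, ?_, ?_⟩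
  · intro F hF hadd hadj
    obtain ⟨X, ⟨α⟩⟩ := exists_iso_of_isLeftAdjoint F hadd hadj
    obtain ⟨hG, hα⟩ := exists_isMonoidalTrans_of_iso hF α
    refine ⟨X, (e X).symm hG, α, ?_⟩
    rw [Equiv.apply_symm_apply]
    exact hα
  · intro X Y D E α
    constructor
    · intro hα
      obtain ⟨f, hf⟩ := Bimodule.exists_hom (X := X) (Y := Y) α
      have hf' : f.natTrans W V = α := hf
      refine ⟨f, ⟨(MonData.isHom_iff_isMonoidalTrans (he X D) (he Y E) f).2 (hf' ▸ hα), hf'⟩, ?_⟩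
      rintro g ⟨-, hg⟩
      exact Bimodule.Hom.tensorTrans_injective (hg.trans hf'.symm)
    · rintro ⟨f, ⟨hf, rfl⟩, -⟩
      exact (MonData.isHom_iff_isMonoidalTrans (he X D) (he Y E) f).1 hf
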